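/- Let $k$ be a field of characteristic $0$, let $n\ge 1$, and let $V$ be a $k$-vector space with basis $x_1,\dots,x_n$ and braiding of diagonal type $c(x_i\otimes x_j)=q_{ij}\,x_j\otimes x_i$, where $q=(q_{ij})\in (k^\times)^{n\times n}$. **Notation.** For $\underline m=(m_1,\dots,m_n)\in\mathbb N_0^n$ let $|\underline m|=\sum_i m_i$, and let $e_1,\dots,e_n$ be the standard basis vectors of $\mathbb N_0^n$. Write $\underline l<\underline m$ if $l_i\le m_i$ for all $i$ and $\underline l\ne\underline m$. For $\underline m\neq 0$ let $\gcd(\underline m)=\gcd(m_1,\dots,m_n)$. Let $\ell_{\underline m}$ be the number of Lyndon words over the ordered alphabet $\{1,\dots,n\}$ in which each letter $i$ occurs exactly $m_i$ times; here a nonempty word $w$ is Lyndon if $w\le v$ lexicographically for every factorization $w=uv$ into nonempty words. For $|\underline m|\ge 2$ let $$N(\underline m)=\gcd\{m_i(m_i-1),\,m_jm_l\mid 1\le i,j,l\le n,\ j<l\},$$ $$Q_{\underline m}=\prod_{i}p_{ii}^{m_i(m_i-1)/N(\underline m)}\prod_{i<j}(p_{ij}p_{ji})^{m_im_j/N(\underline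 m)}\in\mathbb Z[p_{ij}\mid 1\le i,j\le n].$$ With $(r)_a=1+a+\dots+a^{r-1}$, define $P_{\underline m}\in\mathbb Z[p_{ij}\mid 1\le i,j\le n]$ for $|\underline m|\ge 2$ as follows, where $i\ne j$ in (2)–(7): 1. $P_{\underline m}=(m_i)_{p_{ii}}$ if $\underline m=m_ie_i$; 2. $P_{\underline m}=1-p_{jj}^{m_j-1}p_{ij}p_{ji}$ if $\underline m=e_i+m_je_j$, $m_j\ge1$; 3. $P_{\underline m}=1+p_{jj}^{m_j(m_j-1)/2}(-p_{ij}p_{ji})^{m_j}p_{ii}$ if $\underline m=2e_i+m_je_j$, $m_j\ge 1$; 4. $P_{\underline m}=(3)_{p_{ii}^2(p_{ij}p_{ji})^3p_{jj}^2}$ if $\underline m=3e_i+3e_j$; 5. $P_{\underline m}=(1-p_{ii}^2(p_{ij}p_{ji})^4p_{jj}^4)\,(3)_{p_{ii}(p_{ij}p_{ji})^2p_{jj}^2}$ if $\underline m=3e_i+4e_j$; 6. $P_{\underline m}=(1-p_{ii}(p_{ij}p_{ji})^3p_{jj}^5)\,(3)_{p_{ii}^2(p_{ij}p_{ji})^6p_{jj}^{10}}$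 if $\underline m=3e_i+6e_j$; 7. $P_{\underline m}=(1+p_{ii}^3(p_{ij}p_{ji})^4p_{jj}^3)(1+p_{ii}^6(p_{ij}p_{ji})^8p_{jj}^6)$ if $\underline m=4e_i+4e_j$; 8. $P_{\underline m}=1-\prod_i p_{ii}^{m_i(m_i-1)}\prod_{i<j}(p_{ij}p_{ji})^{m_im_j}$ otherwise. (Where these cases overlap the formulas agree.) For a polynomial $f\in\mathbb Z[p_{ij}]$ let $f(q)\in k$ be its value at $p_{ij}=q_{ij}$. For $m\ge2$ let $\mathbb B_m$ be the braid monoid with generators $\sigma_1,\dots,\sigma_{m-1}$, and let $\rho_m:k\mathbb B_m\to\operatorname{End}(V^{\otimes m})$ be the algebra map for which $\rho_m(\sigma_i)$ is $c$ applied to the $i$-th and $(i+1)$-th tensor factors. Let $$S_{1,m-1}=1+\sigma_1+\sigma_2\sigma_1+\dots+\sigma_{m-1}\cdots\sigma_2\sigma_1\in k\mathbb B_m .$$ For $|\underline m|=m$ let $V_{\underline m}\subseteq V^{\otimes m}$ be the span of all $x_{i_1}\otimes\dots\otimes x_{i_m}$ in which each index $i$ occurs exactly $m_i$ times. **Theorem.**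 Let $\underline m\in\mathbb N_0^n$ with $m=|\underline m|\ge 2$. Assume that $P_{\underline m}(q)=0$ and that $P_{\underline l}(q)\neq0$ for all $\underline l<\underline m$ with $|\underline l|\ge2$. Let $d'=N(\underline m)/\operatorname{ord}(Q_{\underline m}(q))$, where $\operatorname{ord}$ denotes the multiplicative order in $k^\times$ (under these assumptions $Q_{\underline m}(q)^{N(\underline m)}=1$, so $d'$ is a positive integer), and let $$n_1(q)=\sum_{i:\,m_i>0}\ \sum_{r\mid\gcd(\underline m-e_i),\ r\mid d'}\ell_{(\underline m-e_i)/r},\qquad n_2(q)=\sum_{r\mid\gcd(\underline m),\ r\mid d'}\ell_{\underline m/r}.$$ Then $$\dim\ker\bigl(\rho_m(S_{1,m-1})|_{V_{\underline m}}\bigr)=n_1(q)-n_2(q).$$ -/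

import Mathlib

open scoped TensorProduct

noncomputable section

namespace ShuffleKernel

/-! ### Degrees, words, Lyndon words -/

/-- The standard basis vector `e_i` of `ℕ₀ⁿ`. -/
def e {n : ℕ} (i : Fin n) : Fin n → ℕ := Pi.single i 1

/-- `|m| = m₁ + ⋯ + mₙ`. -/
def size {n : ℕ} (m : Fin n → ℕ) : ℕ := ∑ i, m i

/-- `gcd(m) = gcd(m₁, …, mₙ)`. -/
def gcdVec {n : ℕ} (m : Fin n → ℕ) : ℕ := Finset.univ.gcd m

/-- `m / k = (m₁ / k, …, mₙ / k)`; only used when `k` divides every entry of `m`. -/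
def divVec {n : ℕ} (m : Fin n → ℕ) (k : ℕ) : Fin n → ℕ := fun i => m i / k

/-- `N(m) = gcd {mᵢ(mᵢ - 1), mⱼmₖ | i, j, k with j < k}`. -/
def N {n : ℕ} (m : Fin n → ℕ) : ℕ :=
  Nat.gcd (Finset.univ.gcd fun i => m i * (m i - 1))
    ((Finset.univ.filter fun a : Fin n × Fin n => a.1 < a.2).gcd fun a => m a.1 * m a.2)

/-- The degree of a word over the alphabet `{1, …, n}`: the number of occurrences of each letter. -/
def wordDegree {n : ℕ} (w : List (Fin n)) : Fin n → ℕ := fun i => w.count i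

/-- A nonempty word `w` is Lyndon if `w ≤ v` lexicographically for every decomposition `w = uv`
into nonempty words. -/
def IsLyndon {n : ℕ} (w : List (Fin n)) : Prop :=
  w ≠ [] ∧ ∀ u v : List (Fin n), u ≠ [] → v ≠ [] → w = u ++ v → w ≤ v

/-- `ℓ_m`, the number of Lyndon words of degree `m`. -/
def lyndonCount {n : ℕ} (m : Fin n → ℕ) : ℕ :=
  {w : List (Fin n) | IsLyndon w ∧ wordDegree w = m}.ncard

/-! ### The polynomials `P_m` and `Q_m` in `ℤ[p_ij]` -/

/-- The variable `p_ij`. -/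
def p {n : ℕ} (i j : Fin n) : MvPolynomial (Fin n × Fin n) ℤ := MvPolynomial.X (i, j)

/-- `(m)_q = 1 + q + ⋯ + q^(m-1)`. -/
def qInt {R : Type*} [Semiring R] (m : ℕ) (q : R) : R := ∑ t ∈ Finset.range m, q ^ t

open Classical in
/-- The polynomial `P_m`. In each case the index `i`, or the pair `(i, j) = (a.1, a.2)`, is
determined by `m` when `|m| ≥ 2`, except that `i` and `j` may be exchanged when `mᵢ = mⱼ`; then the
polynomial is symmetric in `i` and `j`. -/
def P {n : ℕ} (m : Fin n → ℕ) : MvPolynomial (Fin n × Fin n) ℤ :=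
  if h : ∃ i : Fin n, 0 < m i ∧ m = m i • e i then
    let i := h.choose
    qInt (m i) (p i i)
  else if h : ∃ a : Fin n × Fin n, a.1 ≠ a.2 ∧ 0 < m a.2 ∧ m = e a.1 + m a.2 • e a.2 then
    let i := h.choose.1
    let j := h.choose.2
    1 - p j j ^ (m j - 1) * (p i j * p j i)
  else if h : ∃ a : Fin n × Fin n, a.1 ≠ a.2 ∧ 0 < m a.2 ∧ m = 2 • e a.1 + m a.2 • e a.2 then
    let i := h.choose.1
    let j := h.choose.2
    1 + p j j ^ (m j * (m j - 1) / 2) * (-(p i j * p j i)) ^ m j * p i i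
  else if h : ∃ a : Fin n × Fin n, a.1 ≠ a.2 ∧ m = 3 • e a.1 + 3 • e a.2 then
    let i := h.choose.1
    let j := h.choose.2
    qInt 3 (p i i ^ 2 * (p i j * p j i) ^ 3 * p j j ^ 2)
  else if h : ∃ a : Fin n × Fin n, a.1 ≠ a.2 ∧ m = 3 • e a.1 + 4 • e a.2 then
    let i := h.choose.1
    let j := h.choose.2
    (1 - p i i ^ 2 * (p i j * p j i) ^ 4 * p j j ^ 4) *
      qInt 3 (p i i * (p i j * p j i) ^ 2 * p j j ^ 2)
  else if h : ∃ a : Fin n × Fin n, a.1 ≠ a.2 ∧ m = 3 • e a.1 + 6 • e a.2 then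
    let i := h.choose.1
    let j := h.choose.2
    (1 - p i i * (p i j * p j i) ^ 3 * p j j ^ 5) *
      qInt 3 (p i i ^ 2 * (p i j * p j i) ^ 6 * p j j ^ 10)
  else if h : ∃ a : Fin n × Fin n, a.1 ≠ a.2 ∧ m = 4 • e a.1 + 4 • e a.2 then
    let i := h.choose.1
    let j := h.choose.2
    (1 + p i i ^ 3 * (p i j * p j i) ^ 4 * p j j ^ 3) *
      (1 + p i i ^ 6 * (p i j * p j i) ^ 8 * p j j ^ 6)
  else
    1 - (∏ i, p i i ^ (m i * (m i - 1))) *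
      ∏ a : Fin n × Fin n with a.1 < a.2, (p a.1 a.2 * p a.2 a.1) ^ (m a.1 * m a.2)

/-- The monomial `Q_m`. -/
def Q {n : ℕ} (m : Fin n → ℕ) : MvPolynomial (Fin n × Fin n) ℤ :=
  (∏ i, p i i ^ (m i * (m i - 1) / N m)) *
    ∏ a : Fin n × Fin n with a.1 < a.2, (p a.1 a.2 * p a.2 a.1) ^ (m a.1 * m a.2 / N m)

/-- The value `f(q)` of a polynomial `f ∈ ℤ[p_ij]` at a matrix `q = (q_ij)`. -/
def evalAt {n : ℕ} {K : Type*} [CommRing K] (q : Fin n → Fin n → K)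
    (f : MvPolynomial (Fin n × Fin n) ℤ) : K :=
  MvPolynomial.aeval (fun a : Fin n × Fin n => q a.1 a.2) f

/-! ### The numbers `n₁(q)` and `n₂(q)` -/

/-- `d' = N(m) / ord(Q_m(q))`, where `ord` is the multiplicative order. -/
def dPrime {n : ℕ} {K : Type*} [Field K] (q : Fin n → Fin n → K) (m : Fin n → ℕ) : ℕ :=
  N m / orderOf (evalAt q (Q m))

/-- `n₁(q)`. -/
def n₁ {n : ℕ} {K : Type*} [Field K] (q : Fin n → Fin n → K) (m : Fin n → ℕ) : ℕ :=
  ∑ i : Fin n with 0 < m i,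
    ∑ k ∈ (gcdVec (m - e i)).divisors with k ∣ dPrime q m, lyndonCount (divVec (m - e i) k)

/-- `n₂(q)`. -/
def n₂ {n : ℕ} {K : Type*} [Field K] (q : Fin n → Fin n → K) (m : Fin n → ℕ) : ℕ :=
  ∑ k ∈ (gcdVec m).divisors with k ∣ dPrime q m, lyndonCount (divVec m k)

/-! ### The braid monoid and the shuffle elements -/

/-- The defining relations of the braid monoid on `r` strands; the generator with index
`i : Fin (r - 1)` is the one usually written `σ_(i+1)`. -/
inductive BraidRel (r : ℕ) : FreeMonoid (Fin (r - 1)) → FreeMonoid (Fin (r - 1)) → Prop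
  | comm (i j : Fin (r - 1)) (h : (i : ℕ) + 2 ≤ j) :
      BraidRel r (FreeMonoid.of i * FreeMonoid.of j) (FreeMonoid.of j * FreeMonoid.of i)
  | braid (i j : Fin (r - 1)) (h : (j : ℕ) = i + 1) :
      BraidRel r (FreeMonoid.of i * FreeMonoid.of j * FreeMonoid.of i)
        (FreeMonoid.of j * FreeMonoid.of i * FreeMonoid.of j)

/-- The braid monoid on `r` strands. -/
abbrev BraidMonoid (r : ℕ) : Type := PresentedMonoid (BraidRel r)

/-- The generators of the braid monoid, indexed from `0`. -/
def σ {r : ℕ} (i : Fin (r - 1)) : BraidMonoid r := PresentedMonoid.of (BraidRel r) i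

/-- The product `σ_t σ_(t-1) ⋯ σ_1` (generators counted from `1`), for `t ≤ r - 1`. -/
def descProd (r t : ℕ) : BraidMonoid r :=
  (((List.finRange (r - 1)).take t).reverse.map σ).prod

/-- `S_{1,s} = 1 + σ_1 + σ_2 σ_1 + ⋯ + σ_s ⋯ σ_2 σ_1` in the monoid ring of the braid monoid on `r`
strands, for `s < r`. -/
def S (K : Type*) [Semiring K] (r s : ℕ) : MonoidAlgebra K (BraidMonoid r) :=
  ∑ t ∈ Finset.range (s + 1), MonoidAlgebra.of K (BraidMonoid r) (descProd r t)

/-! ### Braided vector spaces of diagonal type -/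

section Braiding

variable {K : Type*} [Field K] {V : Type*} [AddCommGroup V] [Module K V]

/-- The braiding `c(xᵢ ⊗ xⱼ) = q_ij xⱼ ⊗ xᵢ` of diagonal type. -/
def diagBraiding {n : ℕ} (x : Module.Basis (Fin n) K V) (q : Fin n → Fin n → K) :
    V ⊗[K] V →ₗ[K] V ⊗[K] V :=
  (x.tensorProduct x).constr K fun a => q a.1 a.2 • (x a.2 ⊗ₜ[K] x a.1)

theorem diagBraiding_apply {n : ℕ} (x : Module.Basis (Fin n) K V) (q : Fin n → Fin n → K)
    (i j : Fin n) : diagBraiding x q (x i ⊗ₜ[K] x j) = q i j • (x j ⊗ₜ[K] x i) := by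
  have h := (x.tensorProduct x).constr_basis K
    (fun a : Fin n × Fin n => q a.1 a.2 • (x a.2 ⊗ₜ[K] x a.1)) (i, j)
  rwa [Module.Basis.tensorProduct_apply] at h

/-- The linear map `a ⊗ b ↦ v₁ ⊗ ⋯ ⊗ a ⊗ ⋯ ⊗ b ⊗ ⋯ ⊗ v_r` which puts `a` and `b` at the two
different positions `i` and `j` of the pure tensor of `v`. -/
def insertTwo {r : ℕ} (i j : Fin r) (hij : i ≠ j) (v : Fin r → V) :
    V ⊗[K] V →ₗ[K] TensorPower K r V :=
  TensorProduct.lift <| LinearMap.mk₂ K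
    (fun a b => PiTensorProduct.tprod K (Function.update (Function.update v i a) j b))
    (fun a a' b => by
      simp only [Function.update_comm hij, MultilinearMap.map_update_add])
    (fun t a b => by
      simp only [Function.update_comm hij, MultilinearMap.map_update_smul])
    (fun a b b' => by simp only [MultilinearMap.map_update_add])
    (fun t a b => by simp only [MultilinearMap.map_update_smul])

theorem insertTwo_tmul {r : ℕ} (i j : Fin r) (hij : i ≠ j) (v : Fin r → V) (a b : V) :
    insertTwo (K := K) i j hij v (a ⊗ₜ[K] b) =
      PiTensorProduct.tprod K (Function.update (Function.update v i a) j b) := rfl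

theorem insertTwo_update_left {r : ℕ} (i j : Fin r) (hij : i ≠ j) (v : Fin r → V) (a : V) :
    insertTwo (K := K) i j hij (Function.update v i a) = insertTwo i j hij v := by
  ext b c
  simp [insertTwo_tmul]

theorem insertTwo_update_right {r : ℕ} (i j : Fin r) (hij : i ≠ j) (v : Fin r → V) (a : V) :
    insertTwo (K := K) i j hij (Function.update v j a) = insertTwo i j hij v := by
  ext b c
  simp [insertTwo_tmul, Function.update_comm hij]

theorem insertTwo_update_add {r : ℕ} (i j : Fin r) (hij : i ≠ j) (v : Fin r → V) (t : Fin r)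
    (hti : t ≠ i) (htj : t ≠ j) (a b : V) :
    insertTwo (K := K) i j hij (Function.update v t (a + b)) =
      insertTwo i j hij (Function.update v t a) + insertTwo i j hij (Function.update v t b) := by
  ext c d
  simp [insertTwo_tmul, Function.update_comm hti, Function.update_comm htj]

theorem insertTwo_update_smul {r : ℕ} (i j : Fin r) (hij : i ≠ j) (v : Fin r → V) (t : Fin r)
    (hti : t ≠ i) (htj : t ≠ j) (s : K) (a : V) :
    insertTwo (K := K) i j hij (Function.update v t (s • a)) =
      s • insertTwo i j hij (Function.update v t a) := by
  ext c d
  simp [insertTwo_tmul, Function.update_comm hti, Function.update_comm htj]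

/-- An endomorphism `c` of `V ⊗ V` applied to the tensor factors at the positions `i ≠ j` of the
`r`-fold tensor power of `V`. -/
def applyAt {r : ℕ} (c : V ⊗[K] V →ₗ[K] V ⊗[K] V) (i j : Fin r) (hij : i ≠ j) :
    Module.End K (TensorPower K r V) :=
  PiTensorProduct.lift <| MultilinearMap.mk'
    (fun v : Fin r → V => insertTwo i j hij v (c (v i ⊗ₜ[K] v j)))
    (fun v t a b => by
      by_cases hti : t = i
      · subst hti
        simp [insertTwo_update_left, Function.update_of_ne hij.symm, TensorProduct.add_tmul]
      · by_cases htj : t = j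
        · subst htj
          simp [insertTwo_update_right, Function.update_of_ne hij, TensorProduct.tmul_add]
        · simp [insertTwo_update_add i j hij v t hti htj, Function.update_of_ne (Ne.symm hti),
            Function.update_of_ne (Ne.symm htj)])
    (fun v t s a => by
      by_cases hti : t = i
      · subst hti
        simp [insertTwo_update_left, Function.update_of_ne hij.symm, ← TensorProduct.smul_tmul']
      · by_cases htj : t = j
        · subst htj
          simp [insertTwo_update_right, Function.update_of_ne hij]
        · simp [insertTwo_update_smul i j hij v t hti htj, Function.update_of_ne (Ne.symm hti),
            Function.update_of_ne (Ne.symm htj)])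

theorem applyAt_tprod {r : ℕ} (c : V ⊗[K] V →ₗ[K] V ⊗[K] V) (i j : Fin r) (hij : i ≠ j)
    (v : Fin r → V) :
    applyAt c i j hij (PiTensorProduct.tprod K v) = insertTwo i j hij v (c (v i ⊗ₜ[K] v j)) := by
  simp [applyAt, PiTensorProduct.lift.tprod]

/-- The left one of the two tensor factors on which the generator with index `i` acts. -/
def posL {r : ℕ} (i : Fin (r - 1)) : Fin r := ⟨i, by omega⟩

/-- The right one of the two tensor factors on which the generator with index `i` acts. -/
def posR {r : ℕ} (i : Fin (r - 1)) : Fin r := ⟨i + 1, by omega⟩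

theorem posL_ne_posR {r : ℕ} (i : Fin (r - 1)) : posL i ≠ posR i := by
  simp [posL, posR, Fin.ext_iff]

variable {n : ℕ} (x : Module.Basis (Fin n) K V) (q : Fin n → Fin n → K)

/-- The tensor `x_{w₁} ⊗ ⋯ ⊗ x_{w_r}` of a word `w`. -/
def wordTensor {r : ℕ} (w : Fin r → Fin n) : TensorPower K r V :=
  PiTensorProduct.tprod K fun t => x (w t)

/-- The braiding applied to two neighbouring tensor factors. -/
def braidOp {r : ℕ} (i : Fin (r - 1)) : Module.End K (TensorPower K r V) :=
  applyAt (diagBraiding x q) (posL i) (posR i) (posL_ne_posR i)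

theorem braidOp_wordTensor {r : ℕ} (i : Fin (r - 1)) (w : Fin r → Fin n) :
    braidOp x q i (wordTensor x w) =
      q (w (posL i)) (w (posR i)) • wordTensor x (w ∘ Equiv.swap (posL i) (posR i)) := by
  rw [wordTensor, braidOp, applyAt_tprod, diagBraiding_apply, map_smul, insertTwo_tmul]
  congr 2
  funext t
  by_cases h2 : t = posR i
  · subst h2; simp
  · by_cases h1 : t = posL i
    · subst h1; simp [Function.update_of_ne h2]
    · simp [Function.update_of_ne h2, Function.update_of_ne h1, Equiv.swap_apply_of_ne_of_ne h1 h2]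

theorem end_ext {r : ℕ} {f g : Module.End K (TensorPower K r V)}
    (h : ∀ w : Fin r → Fin n, f (wordTensor x w) = g (wordTensor x w)) : f = g := by
  refine (Basis.piTensorProduct fun _ : Fin r => x).ext fun w => ?_
  rw [Basis.piTensorProduct_apply]
  exact h w

theorem braidOp_comm {r : ℕ} (i j : Fin (r - 1)) (h : (i : ℕ) + 2 ≤ j) :
    braidOp x q i * braidOp x q j = braidOp x q j * braidOp x q i := by
  refine end_ext x fun w => ?_
  have h1 : posL i ≠ posL j := by simp only [posL, ne_eq, Fin.mk.injEq]; omega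
  have h2 : posL i ≠ posR j := by simp only [posL, posR, ne_eq, Fin.mk.injEq]; omega
  have h3 : posR i ≠ posL j := by simp only [posL, posR, ne_eq, Fin.mk.injEq]; omega
  have h4 : posR i ≠ posR j := by simp only [posR, ne_eq, Fin.mk.injEq]; omega
  have hw : (w ∘ Equiv.swap (posL j) (posR j)) ∘ Equiv.swap (posL i) (posR i) =
      (w ∘ Equiv.swap (posL i) (posR i)) ∘ Equiv.swap (posL j) (posR j) := by
    funext t
    simp only [Function.comp_apply, Equiv.swap_apply_def]
    grind
  simp only [Module.End.mul_apply, braidOp_wordTensor, map_smul, smul_smul, hw,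
    Function.comp_apply, Equiv.swap_apply_of_ne_of_ne h1 h2, Equiv.swap_apply_of_ne_of_ne h3 h4,
    Equiv.swap_apply_of_ne_of_ne h1.symm h3.symm, Equiv.swap_apply_of_ne_of_ne h2.symm h4.symm]
  rw [mul_comm]

theorem braidOp_braid {r : ℕ} (i j : Fin (r - 1)) (h : (j : ℕ) = i + 1) :
    braidOp x q i * braidOp x q j * braidOp x q i =
      braidOp x q j * braidOp x q i * braidOp x q j := by
  refine end_ext x fun w => ?_
  have h1 : posL j = posR i := by simp only [posL, posR, Fin.mk.injEq]; omega
  have h2 : posL i ≠ posR j := by simp only [posL, posR, ne_eq, Fin.mk.injEq]; omega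
  have h3 : posR i ≠ posR j := by simp only [posR, ne_eq, Fin.mk.injEq]; omega
  have h4 : posL i ≠ posR i := posL_ne_posR i
  have hw : ((w ∘ Equiv.swap (posL i) (posR i)) ∘ Equiv.swap (posR i) (posR j)) ∘
        Equiv.swap (posL i) (posR i) =
      ((w ∘ Equiv.swap (posR i) (posR j)) ∘ Equiv.swap (posL i) (posR i)) ∘
        Equiv.swap (posR i) (posR j) := by
    funext t
    simp only [Function.comp_apply, Equiv.swap_apply_def]
    grind
  simp only [Module.End.mul_apply, braidOp_wordTensor, map_smul, smul_smul, h1, hw,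
    Function.comp_apply, Equiv.swap_apply_left, Equiv.swap_apply_right,
    Equiv.swap_apply_of_ne_of_ne h4 h2, Equiv.swap_apply_of_ne_of_ne h2.symm h3.symm]
  congr 1
  ring

/-- The representation `ρ_r` of the monoid ring of the braid monoid on the `r`-fold tensor power of
`V`; the generator `σ_i` acts by the braiding on the `i`-th and `(i+1)`-th tensor factors. -/
def ρ (r : ℕ) : MonoidAlgebra K (BraidMonoid r) →ₐ[K] Module.End K (TensorPower K r V) :=
  MonoidAlgebra.lift K _ (BraidMonoid r) <|
    PresentedMonoid.lift (fun i => braidOp x q i) (by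
      rintro _ _ (⟨i, j, h⟩ | ⟨i, j, h⟩)
      · simpa using braidOp_comm x q i j h
      · simpa using braidOp_braid x q i j h)

/-- `V_m`, the homogeneous component of degree `m` of the tensor algebra of `V`: the span, inside
the tensor power of exponent `|m|`, of the tensors of all words of degree `m`. -/
def component (m : Fin n → ℕ) : Submodule K (TensorPower K (size m) V) :=
  Submodule.span K
    {y | ∃ w : Fin (size m) → Fin n, wordDegree (List.ofFn w) = m ∧ y = wordTensor x w}

end Braiding

end ShuffleKernel

end

/-! Let M = |m|, let c_t be the action of σ_t ⋯ σ_1 on the span of the words of degree m, and put S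
= ∑_{t<M} c_t, S' = ∑_{t<M-1} c_t, C = c_{M-1} and X = C c_1. The relations c_t X = C c_{t+1} give
(1 - C) S = S' (1 - X). If S' is injective, then ker S lies in ker(1 - X). If moreover C^M = 1 and
X^{M-1} = 1, averaging over the powers of C and X shows that S maps ker(1 - X) onto ker(1 - C).
Hence dim ker S = dim ker(1 - X) - dim ker(1 - C) (`finrank_ker_sum_add`).

Both operators are monomial on words: C rotates the whole word, while X keeps the first letter and
rotates the rest. Going once around an orbit multiplies a word by Q^{N/r}, where r is the exponent
of the rotated word, that is, the number of copies of its primitive root. The fixed space has one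
dimension for each orbit with scalar 1, equivalently with r ∣ d', and the orbits of exponent r in
degree l are counted by the Lyndon words of degree l/r. So the two dimensions are n₂ and n₁
(`finrank_ker_one_sub_rot`, `finrank_ker_one_sub_twist`).

Since S' does not touch the last letter, its injectivity reduces to that of S in the degrees m - e_i
(`injective_sum_moveOp`). This follows by induction on the size from the nonvanishing of the P_l
(`injective_shuffleOp`). If Q_l^{N(l)} ≠ 1, this value is the scalar by which X^{|l|-1} acts, so X
fixes no nonzero vector and the kernel is 0. If Q_l^{N(l)} = 1, the kernel has dimension n₁ - n₂,
and P_l(q) ≠ 0 forces n₁ ≤ n₂. That implication, together with P = 0 ⇒ Q^N = 1, is `detects_P`: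
immediate when P = 1 - Q^N, and a count of Lyndon words in the seven special families. -/

namespace ShuffleKernel

/-! ### Periods and powers of words. -/

section Words

variable {α : Type*}

/-- The least `d > 0` such that rotating `w` by `d` letters gives back `w`. -/
noncomputable def rotPeriod (w : List α) : ℕ := Function.minimalPeriod (fun l : List α => l.rotate 1) w

theorem rotate_one_iterate (k : ℕ) (w : List α) :
    (fun l : List α => l.rotate 1)^[k] w = w.rotate k := by
  induction k generalizing w with
  | zero => simp
  | succ k ih => rw [Function.iterate_succ_apply, ih, List.rotate_rotate, Nat.add_comm]

theorem rotate_eq_self_iff (w : List α) (k : ℕ) : w.rotate k = w ↔ rotPeriod w ∣ k := by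
  rw [← rotate_one_iterate]
  exact Function.isPeriodicPt_iff_minimalPeriod_dvd

theorem rotPeriod_dvd_length (w : List α) : rotPeriod w ∣ w.length :=
  (rotate_eq_self_iff w _).1 (List.rotate_length w)

theorem rotPeriod_pos {w : List α} (hw : w ≠ []) : 0 < rotPeriod w :=
  Nat.pos_of_dvd_of_pos (rotPeriod_dvd_length w) (List.length_pos_of_ne_nil hw)

theorem rotPeriod_eq_of_forall {w : List α} {d : ℕ} (h : ∀ k, w.rotate k = w ↔ d ∣ k) :
    rotPeriod w = d :=
  Nat.dvd_antisymm ((rotate_eq_self_iff w d).1 ((h d).2 dvd_rfl))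
    ((h _).1 ((rotate_eq_self_iff w _).2 dvd_rfl))

/-- A nonempty word is primitive if it is not a proper power of another word. -/
def IsPrimitiveWord (w : List α) : Prop := w ≠ [] ∧ rotPeriod w = w.length

theorem rotPeriod_rotate (w : List α) (i : ℕ) : rotPeriod (w.rotate i) = rotPeriod w := by
  refine rotPeriod_eq_of_forall fun k => ?_
  rw [← rotate_eq_self_iff, List.rotate_rotate, Nat.add_comm, ← List.rotate_rotate,
    List.rotate_eq_rotate]

theorem IsPrimitiveWord.rotate {w : List α} (hw : IsPrimitiveWord w) (i : ℕ) :
    IsPrimitiveWord (w.rotate i) :=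
  ⟨by simpa using hw.1, by rw [rotPeriod_rotate, hw.2, List.length_rotate]⟩

theorem IsPrimitiveWord.rotate_injOn {w : List α} (hw : IsPrimitiveWord w) {i j : ℕ}
    (hi : i < w.length) (hj : j < w.length) (h : w.rotate i = w.rotate j) : i = j := by
  wlog hij : i ≤ j generalizing i j
  · exact (this hj hi h.symm (by omega)).symm
  obtain ⟨k, rfl⟩ := Nat.exists_eq_add_of_le hij
  rw [Nat.add_comm, ← List.rotate_rotate, List.rotate_eq_rotate, eq_comm, rotate_eq_self_iff,
    hw.2] at h
  have := Nat.eq_zero_of_dvd_of_lt h (by omega)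
  omega

/-- The `r`-th power of a word. -/
def wordPow (u : List α) (r : ℕ) : List α := (List.replicate r u).flatten

@[simp] theorem wordPow_zero (u : List α) : wordPow u 0 = [] := by simp [wordPow]

theorem wordPow_succ (u : List α) (r : ℕ) : wordPow u (r + 1) = u ++ wordPow u r := by
  simp [wordPow, List.replicate_succ]

@[simp] theorem length_wordPow (u : List α) (r : ℕ) : (wordPow u r).length = r * u.length := by
  simp [wordPow]

theorem append_wordPow_comm (u : List α) (r : ℕ) : u ++ wordPow u r = wordPow u r ++ u := by
  induction r with
  | zero => simp
  | succ r ih => rw [wordPow_succ, List.append_assoc, ← ih]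

/-- The word `x` is then a prefix of `y`; stripping it off leaves a shorter word that still commutes
with `x`. -/
theorem eq_wordPow_of_commute {x y : List α} {k : ℕ} (h : x ++ y = y ++ x)
    (hk : y.length = k * x.length) : y = wordPow x k := by
  induction k generalizing y with
  | zero => simpa using hk
  | succ k ih =>
    have hp : x <+: y := by
      refine List.prefix_of_prefix_length_le (l₃ := y ++ x) ?_ (List.prefix_append _ _) ?_
      · rw [← h]; exact List.prefix_append _ _
      · rw [hk]; nlinarith
    obtain ⟨z, rfl⟩ := hp
    rw [wordPow_succ, ← ih (y := z)]
    · simpa using h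
    · have := hk; simp only [List.length_append] at this; linarith [Nat.succ_mul k x.length]

theorem rotate_length_wordPow (u : List α) (r : ℕ) :
    (wordPow u r).rotate u.length = wordPow u r := by
  cases r with
  | zero => simp
  | succ r => rw [wordPow_succ, List.rotate_append_length_eq, append_wordPow_comm]

theorem take_wordPow (u : List α) {r : ℕ} (hr : 0 < r) : (wordPow u r).take u.length = u := by
  obtain ⟨r, rfl⟩ := Nat.exists_eq_succ_of_ne_zero hr.ne'
  simp [wordPow_succ]

/-- Invariance under rotation by `d` says that the prefix of length `d` commutes with the rest of
the word. -/
theorem eq_wordPow_of_rotate {w : List α} {d r : ℕ} (hd : w.rotate d = w)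
    (hr : w.length = r * d) (hr0 : 0 < r) : w = wordPow (w.take d) r := by
  obtain ⟨r, rfl⟩ := Nat.exists_eq_succ_of_ne_zero hr0.ne'
  have hle : d ≤ w.length := by rw [hr]; nlinarith
  have hlen : (w.take d).length = d := by simp [hle]
  have h1 : w.drop d ++ w.take d = w.take d ++ w.drop d := by
    rw [← List.rotate_eq_drop_append_take hle, hd, List.take_append_drop]
  rw [Nat.succ_eq_add_one, wordPow_succ,
    ← eq_wordPow_of_commute h1.symm (k := r), List.take_append_drop]
  rw [hlen, List.length_drop, hr, Nat.succ_mul]; omega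

/-- Rotating a power by less than |u| gives the power of the rotated `u`, and the prefix of length
|u| recovers the base. So `u` and its power are fixed by the same rotations. -/
theorem rotPeriod_wordPow {u : List α} {r : ℕ} (hr : 0 < r) :
    rotPeriod (wordPow u r) = rotPeriod u := by
  refine rotPeriod_eq_of_forall fun k => ?_
  rcases eq_or_ne u [] with rfl | hu
  · have : wordPow ([] : List α) r = [] := by
      rw [← List.length_eq_zero_iff]; simp
    rw [this, rotate_eq_self_iff]
  rw [← rotate_eq_self_iff]
  have hpos := List.length_pos_of_ne_nil hu
  have hk : k % u.length < u.length := Nat.mod_lt _ hpos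
  rw [← List.rotate_mod u]
  have hkk : (wordPow u r).rotate k = (wordPow u r).rotate (k % u.length) := by
    conv_lhs => rw [← Nat.div_add_mod k u.length, ← List.rotate_rotate]
    congr 1
    exact (rotate_eq_self_iff _ _).2 (((rotate_eq_self_iff _ _).1
      (rotate_length_wordPow u r)).mul_right _)
  rw [hkk]
  obtain ⟨r, rfl⟩ := Nat.exists_eq_succ_of_ne_zero hr.ne'
  set j := k % u.length
  have hrot : ∀ r, (wordPow u r).rotate j = wordPow (u.rotate j) r := by
    intro r
    -- With u = xy this is y(xy)^r = (yx)^r y.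
    have key : ∀ r, u.drop j ++ wordPow u r = wordPow (u.rotate j) r ++ u.drop j := by
      intro r
      induction r with
      | zero => simp
      | succ r ih =>
        rw [wordPow_succ, wordPow_succ, List.append_assoc, ← ih,
          List.rotate_eq_drop_append_take hk.le]
        nth_rw 2 [← List.take_append_drop j u]
        simp only [List.append_assoc]
    cases r with
    | zero => simp
    | succ r =>
      rw [wordPow_succ]
      nth_rw 1 [← List.take_append_drop j u]
      have : (u.take j).length = j := by simp [hk.le]
      conv_lhs => rw [List.append_assoc]; arg 2; rw [← this]
      rw [List.rotate_append_length_eq, key, wordPow_succ, append_wordPow_comm,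
        List.rotate_eq_drop_append_take hk.le, List.append_assoc]
  rw [hrot]
  constructor
  · intro h
    have h2 := congrArg (List.take u.length) h
    rwa [take_wordPow u hr, show u.length = (u.rotate j).length by simp,
      take_wordPow _ hr] at h2
  · intro h; rw [h]

end Words

/-! ### Lyndon words and the number of words of given exponent. -/

section Lyndon

variable {n : ℕ}

/-- If `v` is not a prefix of `w`, the comparison is decided at some letter, and no extension
changes it. -/
theorem append_lt_append_of_not_isPrefix {v w : List (Fin n)} (h : v < w) (hp : ¬ v <+: w)
    (s t : List (Fin n)) : v ++ s < w ++ t := by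
  induction v generalizing w with
  | nil => exact absurd List.nil_prefix hp
  | cons a v ih =>
    cases w with
    | nil => exact absurd h (List.not_lt_nil _)
    | cons b w =>
      rw [List.cons_append, List.cons_append, List.cons_lt_cons_iff]
      rcases List.cons_lt_cons_iff.1 h with h1 | ⟨rfl, h1⟩
      · exact Or.inl h1
      · exact Or.inr ⟨rfl, ih h1 (by simpa using hp)⟩

theorem append_lt_append_of_length_eq {u t : List (Fin n)} (h : u < t) (hl : u.length = t.length)
    (s s' : List (Fin n)) : u ++ s < t ++ s' :=
  append_lt_append_of_not_isPrefix h (fun hp => h.ne (hp.eq_of_length hl)) s s'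

/-- Passes from suffixes to rotations. For the converse, a suffix v < w of w = uv must be a prefix,
since otherwise vu < w. Then w = vt with |t| = |u|, and vt < vu gives t < u, so the rotation tv is
smaller than uv = w. -/
theorem isLyndon_iff_lt_append {w : List (Fin n)} : IsLyndon w ↔
    w ≠ [] ∧ ∀ u v : List (Fin n), u ≠ [] → v ≠ [] → w = u ++ v → w < v ++ u := by
  refine and_congr_right fun hw => ⟨fun h u v hu hv huv => ?_, fun h u v hu hv huv => ?_⟩
  · have hlen : v.length < w.length := by
      rw [huv]; simpa using List.length_pos_of_ne_nil hu
    have hlt : w < v := lt_of_le_of_ne (h u v hu hv huv) (by rintro rfl; exact lt_irrefl _ hlen)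
    simpa using append_lt_append_of_not_isPrefix hlt (fun hp => by have := hp.length_le; omega) [] u
  · by_contra hlt
    rw [not_le] at hlt
    have hp : v <+: w := by
      by_contra hp
      have h1 := append_lt_append_of_not_isPrefix hlt hp u []
      rw [List.append_nil] at h1
      exact lt_asymm h1 (h u v hu hv huv)
    obtain ⟨t, ht⟩ := hp
    have hlen : t.length = u.length := by
      have := congrArg List.length (ht.trans huv); simp at this; omega
    have h1 : v ++ t < v ++ u := by rw [ht]; exact h u v hu hv huv
    have h2 : t < u := by
      rcases lt_trichotomy t u with h' | h' | h'
      · exact h'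
      · exact absurd h1 (by rw [h']; exact lt_irrefl _)
      · exact absurd (List.append_left_lt (l₁ := v) h') (lt_asymm h1)
    have ht0 : t ≠ [] := by
      rw [← List.length_pos_iff, hlen]; exact List.length_pos_of_ne_nil hu
    have h3 := h v t hv ht0 ht.symm
    rw [huv] at h3
    exact lt_asymm h3 (append_lt_append_of_length_eq h2 hlen v v)

theorem isLyndon_iff_lt_rotate {w : List (Fin n)} : IsLyndon w ↔
    w ≠ [] ∧ ∀ i, 0 < i → i < w.length → w < w.rotate i := by
  rw [isLyndon_iff_lt_append]
  refine and_congr_right fun hw => ⟨fun h i hi hiw => ?_, fun h u v hu hv huv => ?_⟩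
  · rw [List.rotate_eq_drop_append_take hiw.le]
    refine h _ _ ?_ ?_ (List.take_append_drop i w).symm
    · rw [← List.length_pos_iff]; simp; omega
    · rw [← List.length_pos_iff]; simp; omega
  · have h1 := h u.length (List.length_pos_of_ne_nil hu)
      (by rw [huv]; simpa using List.length_pos_of_ne_nil hv)
    nth_rw 2 [huv] at h1
    rwa [List.rotate_append_length_eq] at h1

theorem IsLyndon.isPrimitiveWord {w : List (Fin n)} (hw : IsLyndon w) : IsPrimitiveWord w := by
  rw [isLyndon_iff_lt_rotate] at hw
  refine ⟨hw.1, ?_⟩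
  have hpos := rotPeriod_pos hw.1
  have hle := Nat.le_of_dvd (List.length_pos_of_ne_nil hw.1) (rotPeriod_dvd_length w)
  by_contra hne
  have := hw.2 _ hpos (by omega)
  rw [(rotate_eq_self_iff w _).2 dvd_rfl] at this
  exact lt_irrefl _ this

/-- A Lyndon word is the least of its rotations, so a rotation class contains at most one. -/
theorem IsLyndon.eq_of_rotate {w : List (Fin n)} (hw : IsLyndon w) {i : ℕ}
    (hwi : IsLyndon (w.rotate i)) : w.rotate i = w := by
  have hle : ∀ {v : List (Fin n)} (j : ℕ), IsLyndon v → v ≤ v.rotate j := by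
    intro v j hv
    rw [isLyndon_iff_lt_rotate] at hv
    rw [← List.rotate_mod]
    rcases Nat.eq_zero_or_pos (j % v.length) with h | h
    · rw [h, List.rotate_zero]
    · exact (hv.2 _ h (Nat.mod_lt _ (List.length_pos_of_ne_nil hv.1))).le
  refine le_antisymm ?_ (hle i hw)
  -- Rotating by |w| i - i undoes the rotation by i.
  have h1 := hle (w.length * i - i) hwi
  rw [List.rotate_rotate] at h1
  have : i + (w.length * i - i) = w.length * i := by
    have := List.length_pos_of_ne_nil hw.1
    have : i ≤ w.length * i := Nat.le_mul_of_pos_left _ this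
    omega
  rwa [this, List.rotate_length_mul] at h1

/-- The least rotation is Lyndon; primitivity makes it strictly smaller than its other rotations. -/
theorem IsPrimitiveWord.exists_isLyndon_rotate {w : List (Fin n)} (hw : IsPrimitiveWord w) :
    ∃ u : List (Fin n), IsLyndon u ∧ ∃ i < w.length, u.rotate i = w := by
  have hpos := List.length_pos_of_ne_nil hw.1
  obtain ⟨k, hk, hmin⟩ := Finset.exists_min_image (Finset.range w.length) (fun k => w.rotate k)
    ⟨0, by simpa using hpos⟩
  rw [Finset.mem_range] at hk
  refine ⟨w.rotate k, isLyndon_iff_lt_rotate.2 ⟨by simpa using hw.1, fun i hi hiw => ?_⟩, ?_⟩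
  · rw [List.length_rotate] at hiw
    refine lt_of_le_of_ne ?_ ?_
    · rw [List.rotate_rotate, ← List.rotate_mod w (k + i)]
      exact hmin _ (by simpa using Nat.mod_lt _ hpos)
    · intro h
      have h2 := (rotate_eq_self_iff _ i).1 h.symm
      rw [(hw.rotate k).2, List.length_rotate] at h2
      have := Nat.eq_zero_of_dvd_of_lt h2 hiw
      omega
  · refine ⟨(w.length - k) % w.length, Nat.mod_lt _ hpos, ?_⟩
    have : (w.rotate k).rotate ((w.length - k) % w.length) = (w.rotate k).rotate (w.length - k) := by
      conv_rhs => rw [← List.rotate_mod, List.length_rotate]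
    rw [this, List.rotate_rotate, Nat.add_sub_cancel' hk.le, List.rotate_length]

theorem wordDegree_rotate (w : List (Fin n)) (i : ℕ) : wordDegree (w.rotate i) = wordDegree w := by
  funext j; exact (List.rotate_perm w i).count_eq j

theorem wordDegree_append (u v : List (Fin n)) :
    wordDegree (u ++ v) = wordDegree u + wordDegree v := by
  funext j; simp [wordDegree]

theorem wordDegree_cons (a : Fin n) (v : List (Fin n)) :
    wordDegree (a :: v) = e a + wordDegree v := by
  funext j
  rcases eq_or_ne j a with rfl | h
  · simp [wordDegree, e, Nat.add_comm]
  · simp [wordDegree, e, h, List.count_cons_of_ne h.symm]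

theorem wordDegree_wordPow (u : List (Fin n)) (r : ℕ) :
    wordDegree (wordPow u r) = r • wordDegree u := by
  induction r with
  | zero => funext j; simp [wordDegree]
  | succ r ih => rw [wordPow_succ, wordDegree_append, ih, succ_nsmul']

theorem size_wordDegree (w : List (Fin n)) : size (wordDegree w) = w.length := by
  have := Multiset.sum_count_eq_card (s := Finset.univ) (m := (w : Multiset (Fin n))) (by simp)
  simpa [size, wordDegree] using this

theorem length_of_wordDegree {w : List (Fin n)} {m : Fin n → ℕ} (h : wordDegree w = m) :
    w.length = size m := by rw [← h, size_wordDegree]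

theorem finite_wordDegree (m : Fin n → ℕ) : {w : List (Fin n) | wordDegree w = m}.Finite :=
  (List.finite_length_eq (Fin n) (size m)).subset fun _ hw => length_of_wordDegree hw

/-- The finite set of words of degree `m`. -/
noncomputable def words (m : Fin n → ℕ) : Finset (List (Fin n)) := (finite_wordDegree m).toFinset

@[simp] theorem mem_words {m : Fin n → ℕ} {w : List (Fin n)} : w ∈ words m ↔ wordDegree w = m := by
  simp [words]

-- A primitive word has as many distinct rotations as letters, and exactly one of them is Lyndon.
open Classical in
theorem card_primitive_words (l : Fin n → ℕ) :
    ((words l).filter IsPrimitiveWord).card = size l * lyndonCount l := by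
  have hL : lyndonCount l = ((words l).filter IsLyndon).card := by
    rw [lyndonCount, ← Set.ncard_coe_finset]
    congr 1
    ext w; simp [and_comm]
  rw [hL, Nat.mul_comm, ← Finset.card_range (size l), ← Finset.card_product, eq_comm]
  refine Finset.card_bij (fun a _ => a.1.rotate a.2) ?_ ?_ ?_
  · rintro ⟨u, i⟩ h
    simp only [Finset.mem_product, Finset.mem_filter, mem_words, Finset.mem_range] at h ⊢
    exact ⟨by rw [wordDegree_rotate, h.1.1], h.1.2.isPrimitiveWord.rotate i⟩
  · rintro ⟨u, i⟩ h ⟨v, j⟩ h' heq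
    simp only [Finset.mem_product, Finset.mem_filter, mem_words, Finset.mem_range] at h h' heq
    have hlu := length_of_wordDegree h.1.1
    have hlv := length_of_wordDegree h'.1.1
    have hv : v = u.rotate (i + (v.length - j)) := by
      rw [← List.rotate_rotate, heq, List.rotate_rotate, Nat.add_sub_cancel' (by omega),
        List.rotate_length]
    have huv : v = u := by
      have h2 := h'.1.2
      rw [hv] at h2
      rw [hv]; exact h.1.2.eq_of_rotate h2
    subst huv
    simp only [Prod.mk.injEq, true_and]
    exact h.1.2.isPrimitiveWord.rotate_injOn (by omega) (by omega) heq
  · intro w hw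
    simp only [Finset.mem_filter, mem_words] at hw
    obtain ⟨u, hu, i, hi, hui⟩ := hw.2.exists_isLyndon_rotate
    refine ⟨(u, i), ?_, hui⟩
    simp only [Finset.mem_product, Finset.mem_filter, mem_words, Finset.mem_range]
    exact ⟨⟨by rw [← hw.1, ← hui, wordDegree_rotate], hu⟩, by rwa [← length_of_wordDegree hw.1]⟩

theorem gcdVec_pos {m : Fin n → ℕ} (hm : 0 < size m) : 0 < gcdVec m := by
  rw [Nat.pos_iff_ne_zero, gcdVec, Ne, Finset.gcd_eq_zero_iff]
  intro h
  simp [size, Finset.sum_eq_zero h] at hm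

theorem gcdVec_dvd (m : Fin n → ℕ) (i : Fin n) : gcdVec m ∣ m i :=
  Finset.gcd_dvd (Finset.mem_univ i)

theorem nsmul_divVec {m : Fin n → ℕ} {r : ℕ} (hr : r ∣ gcdVec m) : r • divVec m r = m := by
  funext i
  simp only [Pi.smul_apply, divVec, smul_eq_mul]
  exact Nat.mul_div_cancel' (hr.trans (gcdVec_dvd m i))

theorem size_nsmul (r : ℕ) (m : Fin n → ℕ) : size (r • m) = r * size m := by
  simp [size, Finset.mul_sum]

/-- The exponent of a word of degree `m` divides `gcd(m)`. -/
theorem div_rotPeriod_dvd_gcdVec {m : Fin n → ℕ} (hm : 0 < size m) {w : List (Fin n)}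
    (hw : wordDegree w = m) : size m / rotPeriod w ∣ gcdVec m := by
  have hlen := length_of_wordDegree hw
  have hw0 : w ≠ [] := by rw [← List.length_pos_iff]; omega
  have hd := rotPeriod_dvd_length w
  rw [hlen] at hd
  have hpos : 0 < size m / rotPeriod w :=
    Nat.div_pos (Nat.le_of_dvd hm hd) (rotPeriod_pos hw0)
  have h1 := eq_wordPow_of_rotate ((rotate_eq_self_iff w _).2 dvd_rfl)
    (hlen.trans (Nat.div_mul_cancel hd).symm) hpos
  have h2 := congrArg wordDegree h1
  rw [wordDegree_wordPow, hw] at h2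
  refine Finset.dvd_gcd fun i _ => ?_
  exact ⟨_, congrFun h2 i⟩

/-- The map u ↦ u^r is a bijection from the primitive words of degree m/r to the words of degree m
and exponent r. -/
theorem card_words_exponent {m : Fin n → ℕ} (hm : 0 < size m) {r : ℕ} (hr : r ∣ gcdVec m) :
    ((words m).filter fun w => size m / rotPeriod w = r).card =
      (size m / r) * lyndonCount (divVec m r) := by
  classical
  have hr0 : 0 < r := Nat.pos_of_dvd_of_pos hr (gcdVec_pos hm)
  have hsz : size m = r * size (divVec m r) := by rw [← size_nsmul, nsmul_divVec hr]
  have hsz' : size m / r = size (divVec m r) := by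
    rw [hsz, Nat.mul_div_cancel_left _ hr0]
  rw [hsz', ← card_primitive_words, eq_comm]
  have hpos : 0 < size (divVec m r) := Nat.pos_of_mul_pos_left (hsz ▸ hm)
  refine Finset.card_bij (fun u _ => wordPow u r) ?_ ?_ ?_
  · intro u hu
    simp only [Finset.mem_filter, mem_words] at hu ⊢
    refine ⟨by rw [wordDegree_wordPow, hu.1, nsmul_divVec hr], ?_⟩
    rw [rotPeriod_wordPow hr0, hu.2.2, length_of_wordDegree hu.1, hsz,
      Nat.mul_div_cancel _ hpos]
  · intro u hu v hv huv
    simp only [Finset.mem_filter, mem_words] at hu hv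
    have := congrArg (List.take (size (divVec m r))) huv
    rwa [← length_of_wordDegree hu.1, take_wordPow _ hr0, length_of_wordDegree hu.1,
      ← length_of_wordDegree hv.1, take_wordPow _ hr0] at this
  · intro w hw
    simp only [Finset.mem_filter, mem_words] at hw
    have hlen := length_of_wordDegree hw.1
    have hw0 : w ≠ [] := by rw [← List.length_pos_iff]; omega
    have hd := rotPeriod_dvd_length w
    rw [hlen] at hd
    have hmul : size m = r * rotPeriod w := by rw [← hw.2, Nat.div_mul_cancel hd]
    have h1 := eq_wordPow_of_rotate ((rotate_eq_self_iff w _).2 dvd_rfl)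
      (hlen.trans hmul) hr0
    have hper : rotPeriod w = size (divVec m r) :=
      Nat.eq_of_mul_eq_mul_left hr0 (hmul.symm.trans hsz)
    have hlt : (w.take (rotPeriod w)).length = rotPeriod w := by
      simp [hlen, Nat.le_of_dvd hm hd]
    refine ⟨w.take (rotPeriod w), ?_, h1.symm⟩
    simp only [Finset.mem_filter, mem_words]
    refine ⟨?_, ?_, ?_⟩
    · have h2 := congrArg wordDegree h1
      rw [wordDegree_wordPow, hw.1] at h2
      funext i
      rw [divVec, h2, Pi.smul_apply, smul_eq_mul, Nat.mul_div_cancel_left _ hr0]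
    · rw [← List.length_pos_iff, hlt]; exact rotPeriod_pos hw0
    · rw [← rotPeriod_wordPow (u := w.take (rotPeriod w)) hr0, ← h1, hlt]

/-- Sum over all words of degree `m` of a function of the exponent of the word. -/
theorem sum_words_exponent {m : Fin n → ℕ} (hm : 0 < size m) (φ : ℕ → ℕ) :
    ∑ w ∈ words m, φ (size m / rotPeriod w) =
      ∑ r ∈ (gcdVec m).divisors, φ r * ((size m / r) * lyndonCount (divVec m r)) := by
  rw [← Finset.sum_fiberwise_of_maps_to (t := (gcdVec m).divisors)
    (g := fun w => size m / rotPeriod w)]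
  · refine Finset.sum_congr rfl fun r hr => ?_
    rw [← card_words_exponent hm (Nat.dvd_of_mem_divisors hr), Nat.mul_comm, ← smul_eq_mul,
      ← Finset.sum_const]
    exact Finset.sum_congr rfl fun w hw => by rw [(Finset.mem_filter.1 hw).2]
  · intro w hw
    exact Nat.mem_divisors.2 ⟨div_rotPeriod_dvd_gcdVec hm (mem_words.1 hw), (gcdVec_pos hm).ne'⟩

end Lyndon

/-! ### Fixed spaces of operators of finite order. -/

section LinearAlgebra

variable {K : Type*} [Field K] {W : Type*} [AddCommGroup W] [Module K W]

/-- The average of the powers of an endomorphism. -/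
noncomputable def average (T : Module.End K W) (L : ℕ) : Module.End K W :=
  (L : K)⁻¹ • ∑ i ∈ Finset.range L, T ^ i

theorem average_mul_self {T : Module.End K W} {L : ℕ} (hT : T ^ L = 1) :
    average T L * T = average T L := by
  rw [average, smul_mul_assoc, Finset.sum_mul]
  congr 1
  have h1 := Finset.sum_range_succ (fun i => T ^ i) L
  have h2 := Finset.sum_range_succ' (fun i => T ^ i) L
  rw [h1, hT, pow_zero] at h2
  simpa [pow_succ] using (add_right_cancel h2).symm

theorem self_mul_average {T : Module.End K W} {L : ℕ} (hT : T ^ L = 1) :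
    T * average T L = average T L := by
  refine Eq.trans ?_ (average_mul_self hT)
  simp only [average, mul_smul_comm, smul_mul_assoc, Finset.mul_sum, Finset.sum_mul, ← pow_succ,
    ← pow_succ']

theorem average_apply_of_fixed [CharZero K] {T : Module.End K W} {L : ℕ} (hL : 0 < L) {v : W} (hv : T v = v) :
    average T L v = v := by
  have h : ∀ i, (T ^ i) v = v := by
    intro i
    induction i with
    | zero => simp
    | succ i ih => rw [pow_succ, Module.End.mul_apply, hv, ih]
  have hL' : (L : K) ≠ 0 := by exact_mod_cast hL.ne'
  rw [average, LinearMap.smul_apply, LinearMap.sum_apply, Finset.sum_congr rfl fun i _ => h i,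
    Finset.sum_const, Finset.card_range, ← Nat.cast_smul_eq_nsmul K, smul_smul,
    inv_mul_cancel₀ hL', one_smul]

theorem mem_ker_one_sub {T : Module.End K W} {v : W} : v ∈ LinearMap.ker (1 - T) ↔ T v = v := by
  rw [LinearMap.mem_ker, LinearMap.sub_apply, Module.End.one_apply, sub_eq_zero, eq_comm]

/-- Each v - T^i v telescopes into the image of 1 - T; then average over i. -/
theorem exists_sub_eq_sub_average [CharZero K] {T : Module.End K W} {L : ℕ} (hL : 0 < L) (v : W) :
    ∃ y, v - average T L v = y - T y := by
  have hL' : (L : K) ≠ 0 := by exact_mod_cast hL.ne'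
  have h : ∀ i, ∃ y, v - (T ^ i) v = y - T y := by
    intro i
    induction i with
    | zero => exact ⟨0, by simp⟩
    | succ i ih =>
      obtain ⟨y, hy⟩ := ih
      refine ⟨y + (T ^ i) v, ?_⟩
      rw [pow_succ', Module.End.mul_apply, map_add]
      have : v - T ((T ^ i) v) = (v - (T ^ i) v) + ((T ^ i) v - T ((T ^ i) v)) := by abel
      rw [this, hy]; abel
  choose y hy using h
  refine ⟨(L : K)⁻¹ • ∑ i ∈ Finset.range L, y i, ?_⟩
  rw [map_smul, ← smul_sub, map_sum, ← Finset.sum_sub_distrib,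
    Finset.sum_congr rfl fun i _ => (hy i).symm, Finset.sum_sub_distrib, smul_sub,
    Finset.sum_const, Finset.card_range, ← Nat.cast_smul_eq_nsmul K, smul_smul,
    inv_mul_cancel₀ hL', one_smul, average, LinearMap.smul_apply, LinearMap.sum_apply]

/-! ### The kernel of the shuffle sum in terms of two fixed spaces. -/

section Shuffle

variable {m : ℕ} {c : ℕ → Module.End K W} {X : Module.End K W}

/-- With S and S' the long and the short sum and C = c_m, the relations give S'X = C(S - 1), whence
S'(1 - X) = (S' + C) - CS = S - CS. -/
theorem one_sub_mul_sum (h0 : c 0 = 1) (hX : ∀ t < m, c t * X = c m * c (t + 1)) :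
    (1 - c m) * ∑ t ∈ Finset.range (m + 1), c t =
      (∑ t ∈ Finset.range m, c t) * (1 - X) := by
  rw [mul_sub, mul_one, Finset.sum_mul,
    Finset.sum_congr rfl fun t ht => hX t (Finset.mem_range.1 ht), ← Finset.mul_sum, sub_mul,
    one_mul]
  nth_rw 1 [Finset.sum_range_succ]
  rw [Finset.sum_range_succ', mul_add, h0, mul_one]
  abel

theorem fixed_of_sum_eq_zero (h0 : c 0 = 1) (hX : ∀ t < m, c t * X = c m * c (t + 1))
    (hinj : Function.Injective (∑ t ∈ Finset.range m, c t : Module.End K W)) {v : W}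
    (hv : (∑ t ∈ Finset.range (m + 1), c t : Module.End K W) v = 0) : X v = v := by
  have h := congrArg (fun f : Module.End K W => f v) (one_sub_mul_sum h0 hX)
  simp only [Module.End.mul_apply] at h
  rw [hv, map_zero] at h
  exact mem_ker_one_sub.1 (LinearMap.mem_ker.2 (hinj (by rw [← h, map_zero])))

/-- The kernel of `∑_{t ≤ m} c_t`, when `∑_{t < m} c_t` is injective. -/
theorem finrank_ker_sum_add [CharZero K] [FiniteDimensional K W] (hm : 0 < m) (h0 : c 0 = 1)
    (hX : ∀ t < m, c t * X = c m * c (t + 1)) (hC1 : c m ^ (m + 1) = 1) (hX1 : X ^ m = 1)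
    (hinj : Function.Injective (∑ t ∈ Finset.range m, c t : Module.End K W)) :
    Module.finrank K (LinearMap.ker (∑ t ∈ Finset.range (m + 1), c t : Module.End K W)) +
      Module.finrank K (LinearMap.ker (1 - c m)) = Module.finrank K (LinearMap.ker (1 - X)) := by
  set S : Module.End K W := ∑ t ∈ Finset.range (m + 1), c t with hS
  set S' : Module.End K W := ∑ t ∈ Finset.range m, c t with hS'
  set π := average (c m) (m + 1) with hπ
  have hid : (1 - c m) * S = S' * (1 - X) := one_sub_mul_sum h0 hX
  have hπC : ∀ v, π (c m v) = π v := fun v => by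
    rw [← Module.End.mul_apply, average_mul_self hC1]
  have hSker : ∀ v, X v = v → c m (S v) = S v := fun v hv => by
    have h := congrArg (fun f : Module.End K W => f v) hid
    simp only [Module.End.mul_apply] at h
    rw [show (1 - X) v = 0 by simp [hv], map_zero] at h
    exact mem_ker_one_sub.1 h
  -- Since π absorbs C, π c_{t+1} v = π C c_{t+1} v = π c_t X v = π c_t v.
  have hπc : ∀ v, X v = v → ∀ t ≤ m, π (c t v) = π v := by
    intro v hv t
    induction t with
    | zero => intro _; rw [h0, Module.End.one_apply]
    | succ t ih =>
      intro ht
      rw [← hπC, ← Module.End.mul_apply (c m), ← hX t ht, Module.End.mul_apply, hv, ih (by omega)]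
  have hπS' : ∀ v, X v = v → π (S' v) = (m : K) • π v := fun v hv => by
    rw [hS', LinearMap.sum_apply, map_sum,
      Finset.sum_congr rfl fun t ht => hπc v hv t (Finset.mem_range.1 ht).le, Finset.sum_const,
      Finset.card_range, Nat.cast_smul_eq_nsmul]
  -- S v is fixed by C, so it equals π S v, a sum of m + 1 equal terms.
  have hSv : ∀ v, X v = v → S v = ((m + 1 : ℕ) : K) • π v := fun v hv => by
    rw [← average_apply_of_fixed (Nat.succ_pos m) (hSker v hv), ← hπ, hS, LinearMap.sum_apply,
      map_sum, Finset.sum_congr rfl fun t ht =>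
        hπc v hv t (Nat.lt_succ_iff.1 (Finset.mem_range.1 ht)), Finset.sum_const,
      Finset.card_range, Nat.cast_smul_eq_nsmul]
  have hm0 : (m : K) ≠ 0 := by exact_mod_cast hm.ne'
  let f : LinearMap.ker (1 - X) →ₗ[K] W := S.domRestrict _
  have hrange : LinearMap.range f = LinearMap.ker (1 - c m) := by
    apply le_antisymm
    · rintro _ ⟨⟨v, hv⟩, rfl⟩
      exact mem_ker_one_sub.2 (hSker v (mem_ker_one_sub.1 hv))
    · intro w hw
      rw [mem_ker_one_sub] at hw
      -- In finite dimension S' is also onto. Its preimage u of w is split into an X-fixed part v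
      -- and an element of the image of 1 - X.
      obtain ⟨u, rfl⟩ := (LinearMap.injective_iff_surjective.1 hinj) w
      obtain ⟨y, hy⟩ := exists_sub_eq_sub_average (T := X) hm u
      set v := average X m u with hv
      have hXv : X v = v := by
        rw [hv, ← Module.End.mul_apply, self_mul_average hX1]
      have hu : u = v + (1 - X) y := by
        rw [LinearMap.sub_apply, Module.End.one_apply, ← hy]; abel
      -- The second part contributes S'(1 - X)y = (1 - C)S y, which π kills.
      have hπu : S' u = (m : K) • π v := by
        rw [← average_apply_of_fixed (Nat.succ_pos m) hw, ← hπ, hu, map_add, map_add, hπS' v hXv,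
          ← Module.End.mul_apply S', ← hid, Module.End.mul_apply, LinearMap.sub_apply, map_sub,
          Module.End.one_apply, hπC, sub_self, add_zero]
      -- The factor m/(m+1) reconciles S v = (m+1) π v with S' u = m π v.
      refine ⟨⟨((m : K) * ((m + 1 : ℕ) : K)⁻¹) • v, mem_ker_one_sub.2 (by rw [map_smul, hXv])⟩, ?_⟩
      change S (((m : K) * ((m + 1 : ℕ) : K)⁻¹) • v) = S' u
      have hm1 : ((m + 1 : ℕ) : K) ≠ 0 := by exact_mod_cast Nat.succ_ne_zero m
      rw [map_smul, hSv v hXv, hπu, smul_smul, mul_assoc, inv_mul_cancel₀ hm1, mul_one]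
  have hker : Module.finrank K (LinearMap.ker f) = Module.finrank K (LinearMap.ker S) := by
    have hmap : (LinearMap.ker f).map (LinearMap.ker (1 - X)).subtype = LinearMap.ker S := by
      ext v
      simp only [Submodule.mem_map, LinearMap.mem_ker, Submodule.subtype_apply, Subtype.exists]
      constructor
      · rintro ⟨v, hv, h, rfl⟩; exact h
      · intro h
        exact ⟨v, mem_ker_one_sub.2 (fixed_of_sum_eq_zero h0 hX hinj h), h, rfl⟩
    rw [← hmap]
    exact (LinearEquiv.finrank_eq (Submodule.equivMapOfInjective _ Subtype.val_injective _))
  rw [← hker, ← hrange, Nat.add_comm]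
  exact LinearMap.finrank_range_add_finrank_ker f

end Shuffle

/-! ### Fixed spaces of monomial operators. -/

section Monomial

variable {Ω : Type*}

/-- The scalar picked up along `i` steps by a monomial operator. -/
def orbitProd (g : Ω → Ω) (a : Ω → K) (i : ℕ) (w : Ω) : K := ∏ j ∈ Finset.range i, a (g^[j] w)

theorem pow_monomial (b : Module.Basis Ω K W) {T : Module.End K W} {g : Ω → Ω} {a : Ω → K}
    (hT : ∀ w, T (b w) = a w • b (g w)) (i : ℕ) (w : Ω) :
    (T ^ i) (b w) = orbitProd g a i w • b (g^[i] w) := by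
  induction i with
  | zero => simp [orbitProd]
  | succ i ih =>
    rw [pow_succ', Module.End.mul_apply, ih, map_smul, hT, smul_smul, orbitProd, orbitProd,
      Finset.prod_range_succ, Function.iterate_succ_apply']

theorem pow_mul_period_monomial (b : Module.Basis Ω K W) {T : Module.End K W} {g : Ω → Ω}
    {a : Ω → K} (hT : ∀ w, T (b w) = a w • b (g w)) {p : ℕ} {w : Ω} (hp : g^[p] w = w) (s : ℕ) :
    (T ^ (p * s)) (b w) = orbitProd g a p w ^ s • b w := by
  induction s with
  | zero => simp
  | succ s ih =>
    rw [Nat.mul_succ, pow_add, Module.End.mul_apply, pow_monomial b hT p, hp, map_smul, ih,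
      smul_smul, pow_succ']

/-- The dimension is the trace of the averaging projection. A basis vector w contributes to the
trace of T^i only if `p w` divides i. This leaves the geometric sum of μ(w)^s over s < L / p(w),
which is L / p(w) if μ(w) = 1 and 0 otherwise. -/
theorem finrank_ker_one_sub_monomial [CharZero K] [Fintype Ω] (b : Module.Basis Ω K W) {T : Module.End K W}
    {g : Ω → Ω} {a : Ω → K} (hT : ∀ w, T (b w) = a w • b (g w)) {L : ℕ} (hL : 0 < L)
    (hg : ∀ w, g^[L] w = w) (p : Ω → ℕ) (hp : ∀ w k, g^[k] w = w ↔ p w ∣ k) (μ : Ω → K)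
    (hμ : ∀ w, orbitProd g a (p w) w = μ w) (hμ1 : ∀ w, μ w ^ (L / p w) = 1)
    [DecidablePred fun w => μ w = 1] :
    T ^ L = 1 ∧ L * Module.finrank K (LinearMap.ker (1 - T)) =
      ∑ w, if μ w = 1 then L / p w else 0 := by
  classical
  have hpL : ∀ w, p w ∣ L := fun w => (hp w L).1 (hg w)
  have hpow : ∀ w s, (T ^ (p w * s)) (b w) = μ w ^ s • b w := by
    intro w s
    rw [pow_mul_period_monomial b hT ((hp w _).2 dvd_rfl), hμ]
  have hTL : T ^ L = 1 := by
    refine b.ext fun w => ?_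
    conv_lhs => rw [← Nat.mul_div_cancel' (hpL w)]
    rw [hpow, hμ1, one_smul, Module.End.one_apply]
  refine ⟨hTL, ?_⟩
  have hL' : (L : K) ≠ 0 := by exact_mod_cast hL.ne'
  have hfin : FiniteDimensional K W := b.finiteDimensional_of_finite
  have hproj : LinearMap.IsProj (LinearMap.ker (1 - T)) (average T L) :=
    ⟨fun v => mem_ker_one_sub.2 (by rw [← Module.End.mul_apply, self_mul_average hTL]),
      fun v hv => average_apply_of_fixed hL (mem_ker_one_sub.1 hv)⟩
  have htr := hproj.trace
  rw [average, map_smul, LinearMap.trace_eq_matrix_trace K b, Matrix.trace, smul_eq_mul,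
    inv_mul_eq_iff_eq_mul₀ hL'] at htr
  have hcoord : ∀ w, (LinearMap.toMatrix b b (∑ i ∈ Finset.range L, T ^ i)).diag w =
      ((if μ w = 1 then L / p w else 0 : ℕ) : K) := by
    intro w
    have hpw : 0 < p w := Nat.pos_of_dvd_of_pos (hpL w) hL
    rw [Matrix.diag_apply, LinearMap.toMatrix_apply, LinearMap.sum_apply, map_sum,
      Finsupp.finsetSum_apply]
    have hterm : ∀ i, b.repr ((T ^ i) (b w)) w = if p w ∣ i then μ w ^ (i / p w) else 0 := by
      intro i
      split_ifs with h
      · conv_lhs => rw [← Nat.mul_div_cancel' h]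
        rw [hpow]; simp
      · rw [pow_monomial b hT]
        have : g^[i] w ≠ w := fun h' => h ((hp w i).1 h')
        simp [this]
    rw [Finset.sum_congr rfl fun i _ => hterm i, ← Finset.sum_filter]
    have hbij : ∑ i ∈ (Finset.range L).filter (p w ∣ ·), μ w ^ (i / p w) =
        ∑ s ∈ Finset.range (L / p w), μ w ^ s := by
      symm
      refine Finset.sum_bij (fun s _ => p w * s) ?_ ?_ ?_ ?_
      · intro s hs
        rw [Finset.mem_range] at hs
        rw [Finset.mem_filter, Finset.mem_range]
        refine ⟨?_, dvd_mul_right _ _⟩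
        exact (Nat.lt_div_iff_mul_lt' (hpL w) _).1 hs
      · intro s _ s' _ h
        exact Nat.eq_of_mul_eq_mul_left hpw h
      · intro i hi
        rw [Finset.mem_filter, Finset.mem_range] at hi
        exact ⟨i / p w, Finset.mem_range.2 (Nat.div_lt_div_of_lt_of_dvd (hpL w) hi.1),
          Nat.mul_div_cancel' hi.2⟩
      · intro s _
        rw [Nat.mul_div_cancel_left _ hpw]
    rw [hbij]
    split_ifs with h
    · simp [h]
    · have := geom_sum_mul (μ w) (L / p w)
      rw [hμ1, sub_self] at this
      rw [(mul_eq_zero.1 this).resolve_right (sub_ne_zero.2 h), Nat.cast_zero]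
  rw [Finset.sum_congr rfl fun w _ => hcoord w] at htr
  -- Characteristic 0 turns the trace identity in K into one between natural numbers.
  exact_mod_cast htr.symm

end Monomial

end LinearAlgebra

/-! ### The scalars Q^{N/r} as products of braiding coefficients. -/

section Scalars

variable {n : ℕ}

theorem sub_e_self (m : Fin n → ℕ) (a : Fin n) : (m - e a) a = m a - 1 := by simp [e]

theorem sub_e_of_ne (m : Fin n → ℕ) {a b : Fin n} (h : b ≠ a) : (m - e a) b = m b := by
  simp [e, h]

theorem sub_e_add_e {m : Fin n → ℕ} {a : Fin n} (h : 0 < m a) : (m - e a) + e a = m := by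
  funext b
  rcases eq_or_ne b a with rfl | hb
  · rw [Pi.add_apply, sub_e_self]; simp [e]; omega
  · rw [Pi.add_apply, sub_e_of_ne m hb]; simp [e, hb]

theorem size_add (l m : Fin n → ℕ) : size (l + m) = size l + size m := by
  simp [size, Finset.sum_add_distrib]

theorem size_e (a : Fin n) : size (e a) = 1 := by simp [size, e]

theorem size_sub_e {m : Fin n → ℕ} {a : Fin n} (h : 0 < m a) : size (m - e a) = size m - 1 := by
  have := congrArg size (sub_e_add_e h)
  rw [size_add, size_e] at this
  omega

theorem N_dvd_self (m : Fin n → ℕ) (a : Fin n) : N m ∣ m a * (m a - 1) :=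
  (Nat.gcd_dvd_left _ _).trans
    (Finset.gcd_dvd (f := fun i => m i * (m i - 1)) (Finset.mem_univ a))

theorem N_dvd_of_ne (m : Fin n → ℕ) {a b : Fin n} (h : a ≠ b) : N m ∣ m a * m b := by
  wlog hab : a < b generalizing a b
  · rw [Nat.mul_comm]; exact this h.symm (lt_of_le_of_ne (not_lt.1 hab) h.symm)
  exact (Nat.gcd_dvd_right _ _).trans
    (Finset.gcd_dvd (f := fun a : Fin n × Fin n => m a.1 * m a.2) (b := (a, b)) (by simpa using hab))

/-- The product is m_a(m_a - 1) for b = a and m_a m_b otherwise: a uniform form for all exponents in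
`Q`. -/
theorem N_dvd_sub_e_mul (m : Fin n → ℕ) (a b : Fin n) : N m ∣ (m - e a) b * m a := by
  rcases eq_or_ne b a with rfl | h
  · rw [sub_e_self, Nat.mul_comm]; exact N_dvd_self m b
  · rw [sub_e_of_ne m h]; exact N_dvd_of_ne m h

theorem dvd_N {m : Fin n → ℕ} {r : ℕ} (h1 : ∀ a, r ∣ m a * (m a - 1))
    (h2 : ∀ a b, a ≠ b → r ∣ m a * m b) : r ∣ N m :=
  Nat.dvd_gcd (Finset.dvd_gcd fun a _ => h1 a)
    (Finset.dvd_gcd fun _ ha => h2 _ _ (Finset.mem_filter.1 ha).2.ne)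

theorem N_pos {m : Fin n → ℕ} (hm : 2 ≤ size m) : 0 < N m := by
  rw [Nat.pos_iff_ne_zero]
  intro h0
  have hle : ∀ a, m a ≤ 1 := by
    intro a
    have := N_dvd_self m a
    rw [h0, zero_dvd_iff, mul_eq_zero] at this
    omega
  obtain ⟨a, -, ha⟩ : ∃ a ∈ Finset.univ, m a ≠ 0 := by
    by_contra! hc
    simp [size, Finset.sum_eq_zero hc] at hm
  have : size m = m a := by
    refine Finset.sum_eq_single a (fun b _ hb => ?_) (by simp)
    have := N_dvd_of_ne m hb
    rw [h0, zero_dvd_iff, mul_eq_zero] at this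
    exact this.resolve_right ha
  have := hle a
  omega

theorem dvd_N_of_dvd_gcdVec {m : Fin n → ℕ} {r : ℕ} (hr : r ∣ gcdVec m) : r ∣ N m :=
  dvd_N (fun a => (hr.trans (gcdVec_dvd m a)).mul_right _)
    fun a _ _ => (hr.trans (gcdVec_dvd m a)).mul_right _

/-- Modulo r, m_i is 1 and all other entries are 0, so every generator of N(m) vanishes. -/
theorem dvd_N_of_dvd_gcdVec_sub {m : Fin n → ℕ} {i : Fin n} {r : ℕ}
    (hr : r ∣ gcdVec (m - e i)) : r ∣ N m := by
  have h1 : r ∣ m i - 1 := by rw [← sub_e_self]; exact hr.trans (gcdVec_dvd _ _)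
  have h2 : ∀ a, a ≠ i → r ∣ m a := fun a ha => by
    rw [← sub_e_of_ne m ha]; exact hr.trans (gcdVec_dvd _ _)
  refine dvd_N (fun a => ?_) fun a b hab => ?_
  · rcases eq_or_ne a i with rfl | ha
    · exact h1.mul_left _
    · exact (h2 a ha).mul_right _
  · rcases eq_or_ne a i with rfl | ha
    · exact (h2 b hab.symm).mul_left _
    · exact (h2 a ha).mul_right _

theorem prod_pairs_eq {M : Type*} [CommMonoid M] (f : Fin n → Fin n → M) :
    ∏ a, ∏ b, f a b =
      (∏ a, f a a) * ∏ a : Fin n × Fin n with a.1 < a.2, f a.1 a.2 * f a.2 a.1 := by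
  rw [← Fintype.prod_prod_type', ← Finset.prod_filter_mul_prod_filter_not Finset.univ
    (fun a : Fin n × Fin n => a.1 = a.2), Finset.prod_mul_distrib]
  congr 1
  · symm
    refine Finset.prod_bij (fun a _ => (a, a)) ?_ ?_ ?_ ?_
    · simp
    · intro a _ b _ h; exact congrArg Prod.fst h
    · rintro ⟨a, b⟩ h
      simp only [Finset.mem_filter, Finset.mem_univ, true_and] at h
      subst h
      exact ⟨a, Finset.mem_univ _, rfl⟩
    · simp
  · rw [← Finset.prod_filter_mul_prod_filter_not _ (fun a : Fin n × Fin n => a.1 < a.2)]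
    congr 1
    · refine Finset.prod_congr ?_ fun _ _ => rfl
      ext a
      simp only [Finset.mem_filter, Finset.mem_univ, true_and]
      exact ⟨fun h => h.2, fun h => ⟨h.ne, h⟩⟩
    · refine Finset.prod_bij (fun a _ => (a.2, a.1)) ?_ ?_ ?_ ?_
      · rintro ⟨a, b⟩ h
        simp only [Finset.mem_filter, Finset.mem_univ, true_and] at h ⊢
        exact lt_of_le_of_ne (not_lt.1 h.2) (Ne.symm h.1)
      · rintro ⟨a, b⟩ _ ⟨c, d⟩ _ h
        simp only [Prod.mk.injEq] at h ⊢
        exact ⟨h.2, h.1⟩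
      · rintro ⟨a, b⟩ h
        simp only [Finset.mem_filter, Finset.mem_univ, true_and] at h
        exact ⟨(b, a), by simpa using ⟨h.ne', h.le⟩, rfl⟩
      · simp

variable {K : Type*} [Field K] (q : Fin n → Fin n → K)

theorem evalAt_p (a b : Fin n) : evalAt q (p a b) = q a b := by
  simp [evalAt, p]

/-- The product runs over ordered pairs; a pair a < b occurs twice, as q_ab and as q_ba, with the
same exponent. -/
theorem evalAt_Q (m : Fin n → ℕ) :
    evalAt q (Q m) = ∏ a, ∏ b, q a b ^ ((m - e a) b * m a / N m) := by
  rw [prod_pairs_eq]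
  simp only [Q, evalAt, map_mul, map_prod, map_pow]
  congr 1
  · refine Finset.prod_congr rfl fun a _ => ?_
    rw [sub_e_self, Nat.mul_comm]
    exact congrArg (· ^ _) (evalAt_p q a a)
  · refine Finset.prod_congr rfl fun a ha => ?_
    have ha := (Finset.mem_filter.1 ha).2.ne
    rw [sub_e_of_ne m ha, sub_e_of_ne m ha.symm, Nat.mul_comm (m a.2), mul_pow]
    congr 2
    · exact evalAt_p q _ _
    · exact evalAt_p q _ _

theorem evalAt_Q_pow {m : Fin n → ℕ} (hm : 2 ≤ size m) {r : ℕ} (hr : r ∣ N m) :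
    evalAt q (Q m) ^ (N m / r) = ∏ a, ∏ b, q a b ^ ((m - e a) b * m a / r) := by
  rw [evalAt_Q, ← Finset.prod_pow]
  refine Finset.prod_congr rfl fun a _ => ?_
  rw [← Finset.prod_pow]
  refine Finset.prod_congr rfl fun b _ => ?_
  rw [← pow_mul]
  congr 1
  obtain ⟨s, hs⟩ := N_dvd_sub_e_mul m a b
  obtain ⟨u, hu⟩ := hr
  have hN := N_pos hm
  have hr0 : 0 < r := by
    rcases Nat.eq_zero_or_pos r with rfl | h
    · simp at hu; omega
    · exact h
  rw [hs, Nat.mul_div_cancel_left _ hN, hu, Nat.mul_div_cancel_left _ hr0, Nat.mul_assoc,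
    Nat.mul_div_cancel_left _ hr0, Nat.mul_comm]

/-- The scalar obtained by moving a letter `a` past all other letters of a word of degree `m`. -/
def rowProd (m : Fin n → ℕ) (a : Fin n) : K := ∏ b, q a b ^ (m - e a) b

/-- This is the scalar of one rotation orbit: the primitive root of a word of exponent r contains
each letter a exactly m_a / r times. -/
theorem prod_rowProd_pow {m : Fin n → ℕ} (hm : 2 ≤ size m) {r : ℕ} (hr : r ∣ gcdVec m) :
    ∏ a, rowProd q m a ^ (m a / r) = evalAt q (Q m) ^ (N m / r) := by
  rw [evalAt_Q_pow q hm (dvd_N_of_dvd_gcdVec hr)]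
  refine Finset.prod_congr rfl fun a _ => ?_
  rw [rowProd, ← Finset.prod_pow]
  refine Finset.prod_congr rfl fun b _ => ?_
  rw [← pow_mul, Nat.mul_div_assoc _ (hr.trans (gcdVec_dvd m a))]

/-- The analogue for rotating the tail behind a fixed first letter i, which each letter of the tail
crosses once more. -/
theorem prod_mul_rowProd_pow {m : Fin n → ℕ} (hm : 2 ≤ size m) {i : Fin n} (hi : 0 < m i)
    {r : ℕ} (hr : r ∣ gcdVec (m - e i)) :
    ∏ a, (q i a * rowProd q m a) ^ ((m - e i) a / r) = evalAt q (Q m) ^ (N m / r) := by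
  rw [evalAt_Q_pow q hm (dvd_N_of_dvd_gcdVec_sub hr)]
  simp only [mul_pow]
  rw [Finset.prod_mul_distrib]
  -- All crossings with the first letter are collected in the row a = i, where they supply the copy
  -- of i missing from m - e_i: with m_i = ru + 1 and (m - e_i)_b = rs, the exponents add up to s +
  -- rsu = s m_i.
  have h1 : ∏ b, q i b ^ ((m - e i) b / r) =
      ∏ a, if a = i then ∏ b, q i b ^ ((m - e i) b / r) else 1 := by simp
  rw [h1, ← Finset.prod_mul_distrib]
  refine Finset.prod_congr rfl fun a _ => ?_
  have hd : ∀ b, r ∣ (m - e i) b := fun b => hr.trans (gcdVec_dvd _ b)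
  split_ifs with h
  · subst h
    rw [rowProd, ← Finset.prod_pow, ← Finset.prod_mul_distrib]
    refine Finset.prod_congr rfl fun b _ => ?_
    rw [← pow_mul, ← pow_add]
    congr 1
    obtain ⟨s, hs⟩ := hd b
    obtain ⟨u, hu⟩ := hd a
    have hma : m a = r * u + 1 := by rw [← hu, sub_e_self]; omega
    rcases Nat.eq_zero_or_pos r with rfl | hr0
    · simp
    rw [hs, hu, hma, Nat.mul_div_cancel_left _ hr0, Nat.mul_div_cancel_left _ hr0,
      Nat.mul_assoc r s (r * u + 1), Nat.mul_div_cancel_left _ hr0]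
    ring
  · rw [one_mul, rowProd, ← Finset.prod_pow]
    refine Finset.prod_congr rfl fun b _ => ?_
    rw [← pow_mul, ← Nat.mul_div_assoc _ (hd a), sub_e_of_ne m h]

end Scalars

/-! ### The operators c_t, C and X on words, and their fixed spaces. -/

section WordOperators

variable {n : ℕ}

/-- The word in which the first letter of `w` is moved to the right by `t` places. -/
def moveFirst (t : ℕ) : List (Fin n) → List (Fin n)
  | [] => []
  | a :: w => w.take t ++ a :: w.drop t

@[simp] theorem moveFirst_cons (t : ℕ) (a : Fin n) (w : List (Fin n)) :
    moveFirst t (a :: w) = w.take t ++ a :: w.drop t := rfl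

theorem wordDegree_moveFirst (t : ℕ) (w : List (Fin n)) :
    wordDegree (moveFirst t w) = wordDegree w := by
  cases w with
  | nil => rfl
  | cons a w =>
    rw [moveFirst_cons, wordDegree_append, wordDegree_cons, add_left_comm, ← wordDegree_append,
      List.take_append_drop, wordDegree_cons]

theorem wordDegree_take_rotPeriod {m : Fin n → ℕ} (hm : 0 < size m) {w : List (Fin n)}
    (hw : wordDegree w = m) :
    wordDegree (w.take (rotPeriod w)) = divVec m (size m / rotPeriod w) := by
  have hlen := length_of_wordDegree hw
  have hw0 : w ≠ [] := by rw [← List.length_pos_iff]; omega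
  have hd := rotPeriod_dvd_length w
  rw [hlen] at hd
  have hpos : 0 < size m / rotPeriod w :=
    Nat.div_pos (Nat.le_of_dvd hm hd) (rotPeriod_pos hw0)
  have h2 := congrArg wordDegree (eq_wordPow_of_rotate ((rotate_eq_self_iff w _).2 dvd_rfl)
    (hlen.trans (Nat.div_mul_cancel hd).symm) hpos)
  rw [wordDegree_wordPow, hw] at h2
  funext i
  rw [divVec, congrFun h2 i, Pi.smul_apply, smul_eq_mul, Nat.mul_div_cancel_left _ hpos]

theorem prod_map_eq_prod_pow {K : Type*} [CommMonoid K] (f : Fin n → K) (w : List (Fin n)) :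
    (w.map f).prod = ∏ a, f a ^ wordDegree w a := by
  induction w with
  | nil => simp [wordDegree]
  | cons b w ih =>
    rw [List.map_cons, List.prod_cons, ih, wordDegree_cons]
    simp only [Pi.add_apply, pow_add, Finset.prod_mul_distrib]
    congr 1
    rw [Finset.prod_eq_single b] <;> simp +contextual [e]

theorem prod_head_rotate {K : Type*} [CommMonoid K] (f : Fin n → K) (w : List (Fin n)) {k : ℕ}
    (hk : k ≤ w.length) :
    ∏ j ∈ Finset.range k, (w.rotate j).head?.elim 1 f = ((w.take k).map f).prod := by
  induction k with
  | zero => simp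
  | succ k ih =>
    have hk' : k < w.length := hk
    rw [Finset.prod_range_succ, ih hk'.le, List.head?_rotate hk', List.take_succ_eq_append_getElem hk',
      List.map_append, List.prod_append, List.getElem?_eq_getElem hk']
    simp

variable {K : Type*} [Field K] (q : Fin n → Fin n → K)

/-- The scalar obtained by braiding the first letter of a word with the `t` following letters. -/
def moveCoef (t : ℕ) : List (Fin n) → K
  | [] => 1
  | a :: w => ((w.take t).map (q a)).prod

@[simp] theorem moveCoef_cons (t : ℕ) (a : Fin n) (w : List (Fin n)) :
    moveCoef q t (a :: w) = ((w.take t).map (q a)).prod := rfl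

/-- `moveFirst` as a map on the words of degree `m`. -/
def moveWord (m : Fin n → ℕ) (t : ℕ) (w : words m) : words m :=
  ⟨moveFirst t w.1, mem_words.2 ((wordDegree_moveFirst t w.1).trans (mem_words.1 w.2))⟩

/-- The action of `σ_t ⋯ σ_1` on the span of the words of degree `m`. -/
noncomputable def moveOp (m : Fin n → ℕ) (t : ℕ) : Module.End K (words m →₀ K) :=
  Finsupp.linearCombination K fun w => moveCoef q t w.1 • Finsupp.single (moveWord m t w) (1 : K)

theorem moveOp_single (m : Fin n → ℕ) (t : ℕ) (w : words m) :
    moveOp q m t (Finsupp.single w 1) =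
      moveCoef q t w.1 • Finsupp.single (moveWord m t w) (1 : K) := by
  rw [moveOp, Finsupp.linearCombination_single, one_smul]

theorem words_end_ext {m : Fin n → ℕ} {M : Type*} [AddCommGroup M] [Module K M]
    {f g : (words m →₀ K) →ₗ[K] M}
    (h : ∀ w : words m, f (Finsupp.single w 1) = g (Finsupp.single w 1)) : f = g :=
  Finsupp.basisSingleOne.ext fun w => by simpa using h w

theorem moveOp_zero (m : Fin n → ℕ) : moveOp q m 0 = 1 := by
  refine words_end_ext fun w => ?_
  rw [moveOp_single, Module.End.one_apply]
  have h1 : moveCoef q 0 w.1 = 1 := by cases w.1 <;> simp [moveCoef]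
  have h2 : moveWord m 0 w = w := Subtype.ext (by
    change moveFirst 0 w.1 = w.1
    cases w.1 <;> simp [moveFirst])
  rw [h1, h2, one_smul]

/-- Rotation of words of degree `m`. -/
def rotWord (m : Fin n → ℕ) (w : words m) : words m :=
  ⟨w.1.rotate 1, mem_words.2 ((wordDegree_rotate w.1 1).trans (mem_words.1 w.2))⟩

theorem rotWord_iterate (m : Fin n → ℕ) (w : words m) (k : ℕ) :
    ((rotWord m)^[k] w).1 = w.1.rotate k := by
  induction k with
  | zero => simp
  | succ k ih =>
    rw [Function.iterate_succ_apply']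
    change ((rotWord m)^[k] w).1.rotate 1 = _
    rw [ih, List.rotate_rotate]

/-- The scalar in the action of `σ_{|m|-1} ⋯ σ_1` on a word of degree `m`. -/
noncomputable def rotCoef (m : Fin n → ℕ) (w : words m) : K := w.1.head?.elim 1 (rowProd q m)

theorem length_words {m : Fin n → ℕ} (w : words m) : w.1.length = size m :=
  length_of_wordDegree (mem_words.1 w.2)

theorem exists_cons_of_words {m : Fin n → ℕ} (hm : 0 < size m) (w : words m) :
    ∃ a v, w.1 = a :: v ∧ v.length + 1 = size m ∧ wordDegree v = m - e a := by
  have hl := length_words w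
  obtain ⟨a, v, h⟩ := List.exists_cons_of_ne_nil (l := w.1)
    (by rw [← List.length_pos_iff]; omega)
  refine ⟨a, v, h, by rw [← hl, h, List.length_cons], ?_⟩
  have := mem_words.1 w.2
  rw [h, wordDegree_cons] at this
  rw [← this, add_tsub_cancel_left]

theorem pos_of_cons_words {m : Fin n → ℕ} {a : Fin n} {v : List (Fin n)}
    (h : wordDegree (a :: v) = m) : 0 < m a := by
  rw [← h, wordDegree_cons]; simp [e]

theorem moveOp_last_single {m : Fin n → ℕ} (hm : 0 < size m) (w : words m) :
    moveOp q m (size m - 1) (Finsupp.single w 1) =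
      rotCoef q m w • Finsupp.single (rotWord m w) (1 : K) := by
  obtain ⟨a, v, hw, hl, hv⟩ := exists_cons_of_words hm w
  have htake : v.take (size m - 1) = v := List.take_of_length_le (by omega)
  have hdrop : v.drop (size m - 1) = [] := List.drop_of_length_le (by omega)
  have h1 : moveCoef q (size m - 1) w.1 = rotCoef q m w := by
    rw [rotCoef, hw, moveCoef_cons, htake, prod_map_eq_prod_pow, hv]; rfl
  have h2 : moveWord m (size m - 1) w = rotWord m w := Subtype.ext (by
    change moveFirst _ w.1 = w.1.rotate 1
    rw [hw, moveFirst_cons, htake, hdrop]; simp)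
  rw [moveOp_single, h1, h2]

/-- The action of `σ_{|m|-1} ⋯ σ_2 σ_1²`. -/
noncomputable def twistOp (m : Fin n → ℕ) : Module.End K (words m →₀ K) :=
  moveOp q m (size m - 1) * moveOp q m 1

theorem exists_cons_cons_of_words {m : Fin n → ℕ} (hm : 2 ≤ size m) (w : words m) :
    ∃ a b v, w.1 = a :: b :: v ∧ v.length + 2 = size m := by
  obtain ⟨a, v, hw, hl, -⟩ := exists_cons_of_words (by omega) w
  obtain ⟨b, v, rfl⟩ := List.exists_cons_of_ne_nil (l := v) (by rw [← List.length_pos_iff]; omega)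
  exact ⟨a, b, v, hw, by rw [← hl, List.length_cons]⟩

/-- On a word a b v both sides send b to the end and put a behind the first t letters of v. The
crossings are the same: a past b, a past t letters of v, and b past all other letters. -/
theorem moveOp_mul_twistOp {m : Fin n → ℕ} (hm : 2 ≤ size m) {t : ℕ} (ht : t < size m - 1) :
    moveOp q m t * twistOp q m = moveOp q m (size m - 1) * moveOp q m (t + 1) := by
  refine words_end_ext fun w => ?_
  obtain ⟨a, b, v, hw, hl⟩ := exists_cons_cons_of_words hm w
  simp only [twistOp, Module.End.mul_apply, moveOp_single q m 1, moveOp_single q m (t + 1),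
    map_smul, moveOp_last_single q (show 0 < size m by omega), moveOp_single q m t, smul_smul]
  have htv : t ≤ v.length := by omega
  have hword : moveWord m t (rotWord m (moveWord m 1 w)) = rotWord m (moveWord m (t + 1) w) := by
    refine Subtype.ext ?_
    simp only [moveWord, rotWord, hw]
    simp [List.take_append_of_le_length htv, List.drop_append_of_le_length htv]
  rw [hword]
  congr 1
  simp only [moveWord, rotWord, rotCoef, hw]
  simp [List.take_append_of_le_length htv]
  ring

/-- Rotation of all letters but the first. -/
def rotTail : List (Fin n) → List (Fin n)
  | [] => []
  | a :: w => a :: w.rotate 1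

theorem wordDegree_rotTail (w : List (Fin n)) : wordDegree (rotTail w) = wordDegree w := by
  cases w with
  | nil => rfl
  | cons a v => rw [rotTail, wordDegree_cons, wordDegree_cons, wordDegree_rotate]

/-- `rotTail` on the words of degree `m`. -/
def rotTailWord (m : Fin n → ℕ) (w : words m) : words m :=
  ⟨rotTail w.1, mem_words.2 ((wordDegree_rotTail w.1).trans (mem_words.1 w.2))⟩

theorem rotTailWord_iterate {m : Fin n → ℕ} (w : words m) {a : Fin n} {v : List (Fin n)}
    (h : w.1 = a :: v) (k : ℕ) : ((rotTailWord m)^[k] w).1 = a :: v.rotate k := by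
  induction k with
  | zero => simpa using h
  | succ k ih =>
    rw [Function.iterate_succ_apply']
    change rotTail ((rotTailWord m)^[k] w).1 = _
    rw [ih, rotTail, List.rotate_rotate]

/-- The scalar in the action of `twistOp` on a word. -/
noncomputable def twistCoef (m : Fin n → ℕ) : List (Fin n) → K
  | [] => 1
  | a :: w => w.head?.elim 1 fun b => q a b * rowProd q m b

theorem twistOp_single {m : Fin n → ℕ} (hm : 2 ≤ size m) (w : words m) :
    twistOp q m (Finsupp.single w 1) =
      twistCoef q m w.1 • Finsupp.single (rotTailWord m w) (1 : K) := by
  obtain ⟨a, b, v, hw, hl⟩ := exists_cons_cons_of_words hm w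
  rw [twistOp, Module.End.mul_apply, moveOp_single, map_smul, moveOp_last_single q (by omega),
    smul_smul]
  have hword : rotWord m (moveWord m 1 w) = rotTailWord m w := by
    refine Subtype.ext ?_
    simp only [moveWord, rotWord, rotTailWord, hw]
    simp [rotTail]
  rw [hword]
  congr 1
  simp only [moveWord, rotCoef, hw]
  simp [twistCoef]

/-- During one period each letter of the primitive root comes to the front once and contributes its
row product. -/
theorem orbitProd_rotWord {m : Fin n → ℕ} (hm : 2 ≤ size m) (w : words m) :
    orbitProd (rotWord m) (rotCoef q m) (rotPeriod w.1) w =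
      evalAt q (Q m) ^ (N m / (size m / rotPeriod w.1)) := by
  have h0 : 0 < size m := by omega
  have hl := length_words w
  have hle : rotPeriod w.1 ≤ w.1.length :=
    Nat.le_of_dvd (by omega) (rotPeriod_dvd_length _)
  rw [← prod_rowProd_pow q hm (div_rotPeriod_dvd_gcdVec h0 (mem_words.1 w.2)), orbitProd]
  simp only [rotCoef, rotWord_iterate]
  rw [prod_head_rotate _ _ hle, prod_map_eq_prod_pow,
    wordDegree_take_rotPeriod h0 (mem_words.1 w.2)]
  rfl

theorem orbitProd_rotTailWord {m : Fin n → ℕ} (hm : 2 ≤ size m) (w : words m) :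
    orbitProd (rotTailWord m) (fun w => twistCoef q m w.1) (rotPeriod w.1.tail) w =
      evalAt q (Q m) ^ (N m / ((size m - 1) / rotPeriod w.1.tail)) := by
  obtain ⟨a, v, hw, hl, hv⟩ := exists_cons_of_words (by omega) w
  have ha : 0 < m a := pos_of_cons_words (v := v) (by rw [← hw]; exact mem_words.1 w.2)
  have hsz := size_sub_e ha
  have h0 : 0 < size (m - e a) := by omega
  rw [hw, List.tail_cons, ← hsz,
    ← prod_mul_rowProd_pow q hm ha (div_rotPeriod_dvd_gcdVec h0 hv), orbitProd]
  simp only [rotTailWord_iterate w hw, twistCoef]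
  rw [prod_head_rotate _ _ (Nat.le_of_dvd (by omega) (rotPeriod_dvd_length _)),
    prod_map_eq_prod_pow, wordDegree_take_rotPeriod h0 hv]
  rfl

theorem rotPeriod_tail_dvd {m : Fin n → ℕ} (w : words m) :
    rotPeriod w.1.tail ∣ size m - 1 := by
  rw [← length_words w, ← List.length_tail]
  exact rotPeriod_dvd_length _

theorem rotTailWord_iterate_eq_iff {m : Fin n → ℕ} (hm : 2 ≤ size m) (w : words m) (k : ℕ) :
    (rotTailWord m)^[k] w = w ↔ rotPeriod w.1.tail ∣ k := by
  obtain ⟨a, v, hw, -, -⟩ := exists_cons_of_words (by omega) w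
  rw [← Subtype.coe_inj, rotTailWord_iterate w hw, hw, List.tail_cons, ← rotate_eq_self_iff]
  simp

theorem rotWord_iterate_eq_iff {m : Fin n → ℕ} (w : words m) (k : ℕ) :
    (rotWord m)^[k] w = w ↔ rotPeriod w.1 ∣ k := by
  rw [← Subtype.coe_inj, rotWord_iterate, rotate_eq_self_iff]

theorem exponent_tail_dvd_N {m : Fin n → ℕ} (hm : 2 ≤ size m) (w : words m) :
    (size m - 1) / rotPeriod w.1.tail ∣ N m := by
  obtain ⟨a, v, hw, hl, hv⟩ := exists_cons_of_words (by omega) w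
  have ha : 0 < m a := pos_of_cons_words (v := v) (by rw [← hw]; exact mem_words.1 w.2)
  have hsz := size_sub_e ha
  rw [hw, List.tail_cons, ← hsz]
  exact dvd_N_of_dvd_gcdVec_sub (div_rotPeriod_dvd_gcdVec (by omega) hv)

/-- A full turn of the tail runs through its orbit r times, r being the exponent of the tail, so the
scalar (Q^{N/r})^r is the same for all words. -/
theorem twistOp_pow {m : Fin n → ℕ} (hm : 2 ≤ size m) :
    twistOp q m ^ (size m - 1) = evalAt q (Q m) ^ N m • (1 : Module.End K (words m →₀ K)) := by
  refine words_end_ext fun w => ?_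
  have h1 := pow_mul_period_monomial Finsupp.basisSingleOne (T := twistOp q m)
    (a := fun w => twistCoef q m w.1) (fun w => by simpa using twistOp_single q hm w)
    ((rotTailWord_iterate_eq_iff hm w _).2 dvd_rfl) ((size m - 1) / rotPeriod w.1.tail)
  rw [Nat.mul_div_cancel' (rotPeriod_tail_dvd w), orbitProd_rotTailWord q hm, ← pow_mul,
    Nat.div_mul_cancel (exponent_tail_dvd_N hm w), Finsupp.coe_basisSingleOne] at h1
  rw [h1, LinearMap.smul_apply, Module.End.one_apply]

/-- Both sides say that r · ord(Q) divides N; `hQ` makes the quotient N / ord(Q) exact. -/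
theorem dvd_dPrime_iff {m : Fin n → ℕ} (hm : 2 ≤ size m) (hQ : evalAt q (Q m) ^ N m = 1) {r : ℕ}
    (hr : r ∣ N m) : r ∣ dPrime q m ↔ evalAt q (Q m) ^ (N m / r) = 1 := by
  have hr0 : 0 < r := Nat.pos_of_dvd_of_pos hr (N_pos hm)
  rw [dPrime, ← orderOf_dvd_iff_pow_eq_one, Nat.dvd_div_iff_mul_dvd (orderOf_dvd_of_pow_eq_one hQ),
    Nat.dvd_div_iff_mul_dvd hr, Nat.mul_comm]

-- A word of exponent r has weight r, and each Lyndon word of degree l/r accounts for |l|/r such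
-- words, so it contributes |l| whatever r is.
open Classical in
theorem sum_words_fixed {l m : Fin n → ℕ} (hm : 2 ≤ size m) (hl : 0 < size l)
    (hQ : evalAt q (Q m) ^ N m = 1) (hlm : ∀ r, r ∣ gcdVec l → r ∣ N m) :
    ∑ w ∈ words l, (if evalAt q (Q m) ^ (N m / (size l / rotPeriod w)) = 1
      then size l / rotPeriod w else 0) =
    size l * ∑ r ∈ (gcdVec l).divisors with r ∣ dPrime q m, lyndonCount (divVec l r) := by
  rw [sum_words_exponent hl fun r => if evalAt q (Q m) ^ (N m / r) = 1 then r else 0,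
    Finset.sum_filter, Finset.mul_sum]
  refine Finset.sum_congr rfl fun r hr => ?_
  have hr := Nat.dvd_of_mem_divisors hr
  simp only [← dvd_dPrime_iff q hm hQ (hlm r hr)]
  split_ifs
  · rw [← Nat.mul_assoc, Nat.mul_div_cancel']
    rw [← nsmul_divVec hr, size_nsmul]
    exact dvd_mul_right _ _
  · simp

theorem sum_words_cons {m : Fin n → ℕ} (hm : 0 < size m) (f : List (Fin n) → ℕ) :
    ∑ w ∈ words m, f w = ∑ i : Fin n with 0 < m i, ∑ w ∈ words (m - e i), f (i :: w) := by
  rw [Finset.sum_sigma']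
  symm
  refine Finset.sum_bij (fun a _ => a.1 :: a.2) ?_ ?_ ?_ ?_
  · rintro ⟨i, w⟩ h
    simp only [Finset.mem_sigma, Finset.mem_filter, Finset.mem_univ, true_and, mem_words] at h ⊢
    rw [wordDegree_cons, h.2, add_comm, sub_e_add_e h.1]
  · rintro ⟨i, w⟩ _ ⟨j, v⟩ _ h
    simp only [List.cons.injEq] at h
    obtain ⟨rfl, rfl⟩ := h
    rfl
  · intro w hw
    obtain ⟨a, v, hwa, -, hv⟩ := exists_cons_of_words hm ⟨w, hw⟩
    simp only at hwa
    subst hwa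
    refine ⟨⟨a, v⟩, ?_, rfl⟩
    simp only [Finset.mem_sigma, Finset.mem_filter, Finset.mem_univ, true_and, mem_words]
    exact ⟨pos_of_cons_words (mem_words.1 hw), hv⟩
  · simp

theorem finrank_ker_one_sub_rot [CharZero K] {m : Fin n → ℕ} (hm : 2 ≤ size m)
    (hQ : evalAt q (Q m) ^ N m = 1) :
    moveOp q m (size m - 1) ^ size m = 1 ∧
      Module.finrank K (LinearMap.ker (1 - moveOp q m (size m - 1))) = n₂ q m := by
  classical
  have h0 : 0 < size m := by omega
  have h := finrank_ker_one_sub_monomial Finsupp.basisSingleOne (T := moveOp q m (size m - 1))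
    (fun w => by simpa using moveOp_last_single q h0 w) h0
    (fun w => (rotWord_iterate_eq_iff w _).2 (by
      rw [← length_words w]; exact rotPeriod_dvd_length _))
    (fun w => rotPeriod w.1) rotWord_iterate_eq_iff _ (orbitProd_rotWord q hm) (fun w => by
      rw [← pow_mul, Nat.div_mul_cancel (dvd_N_of_dvd_gcdVec
        (div_rotPeriod_dvd_gcdVec h0 (mem_words.1 w.2))), hQ])
  refine ⟨h.1, Nat.eq_of_mul_eq_mul_left h0 (h.2.trans ?_)⟩
  rw [n₂, ← sum_words_fixed q hm h0 hQ fun r => dvd_N_of_dvd_gcdVec]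
  exact Finset.sum_coe_sort (words m) fun w =>
    if evalAt q (Q m) ^ (N m / (size m / rotPeriod w)) = 1 then size m / rotPeriod w else 0

theorem finrank_ker_one_sub_twist [CharZero K] {m : Fin n → ℕ} (hm : 2 ≤ size m)
    (hQ : evalAt q (Q m) ^ N m = 1) :
    twistOp q m ^ (size m - 1) = 1 ∧
      Module.finrank K (LinearMap.ker (1 - twistOp q m)) = n₁ q m := by
  classical
  have h0 : 0 < size m - 1 := by omega
  have h := finrank_ker_one_sub_monomial Finsupp.basisSingleOne (T := twistOp q m)
    (a := fun w => twistCoef q m w.1) (fun w => by simpa using twistOp_single q hm w) h0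
    (fun w => (rotTailWord_iterate_eq_iff hm w _).2 (rotPeriod_tail_dvd w))
    (fun w => rotPeriod w.1.tail) (rotTailWord_iterate_eq_iff hm) _ (orbitProd_rotTailWord q hm)
    (fun w => by rw [← pow_mul, Nat.div_mul_cancel (exponent_tail_dvd_N hm w), hQ])
  refine ⟨h.1, Nat.eq_of_mul_eq_mul_left h0 (h.2.trans ?_)⟩
  rw [Finset.sum_coe_sort (words m) fun w =>
    if evalAt q (Q m) ^ (N m / ((size m - 1) / rotPeriod w.tail)) = 1
      then (size m - 1) / rotPeriod w.tail else 0, sum_words_cons (by omega), n₁, Finset.mul_sum]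
  refine Finset.sum_congr rfl fun i hi => ?_
  have hi := (Finset.mem_filter.1 hi).2
  have hsz := size_sub_e hi
  simp only [List.tail_cons, ← hsz]
  exact sum_words_fixed q hm (by omega) hQ fun r => dvd_N_of_dvd_gcdVec_sub

/-- The action of `S_{1,|m|-1}` on the span of the words of degree `m`. -/
noncomputable def shuffleOp (m : Fin n → ℕ) : Module.End K (words m →₀ K) :=
  ∑ t ∈ Finset.range (size m), moveOp q m t

theorem finrank_ker_shuffleOp [CharZero K] {m : Fin n → ℕ} (hm : 2 ≤ size m)
    (hQ : evalAt q (Q m) ^ N m = 1)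
    (hinj : Function.Injective
      (∑ t ∈ Finset.range (size m - 1), moveOp q m t : Module.End K (words m →₀ K))) :
    Module.finrank K (LinearMap.ker (shuffleOp q m)) + n₂ q m = n₁ q m := by
  have hs : size m - 1 + 1 = size m := by omega
  have h1 := finrank_ker_one_sub_rot q hm hQ
  have h2 := finrank_ker_one_sub_twist q hm hQ
  rw [← h1.2, ← h2.2, shuffleOp]
  -- The top index of the general statement is |m| - 1, so C has order dividing |m| and X order
  -- dividing |m| - 1.
  have := finrank_ker_sum_add (c := moveOp q m) (X := twistOp q m) (m := size m - 1) (by omega)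
    (moveOp_zero q m) (fun t ht => moveOp_mul_twistOp q hm ht) (by rw [hs]; exact h1.1) h2.1 hinj
  rwa [hs] at this

/-- A vector in the kernel is fixed by X, hence by X^{|m|-1}, which is a scalar different from 1. -/
theorem injective_shuffleOp_of_ne_one {m : Fin n → ℕ} (hm : 2 ≤ size m)
    (hQ : evalAt q (Q m) ^ N m ≠ 1)
    (hinj : Function.Injective
      (∑ t ∈ Finset.range (size m - 1), moveOp q m t : Module.End K (words m →₀ K))) :
    Function.Injective (shuffleOp q m) := by
  have hs : size m - 1 + 1 = size m := by omega
  rw [← LinearMap.ker_eq_bot, LinearMap.ker_eq_bot']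
  intro v hv
  have hX : twistOp q m v = v := fixed_of_sum_eq_zero (c := moveOp q m) (m := size m - 1)
    (moveOp_zero q m) (fun t ht => moveOp_mul_twistOp q hm ht) hinj (by rwa [hs])
  have hpow : ∀ k, (twistOp q m ^ k) v = v := by
    intro k
    induction k with
    | zero => simp
    | succ k ih => rw [pow_succ, Module.End.mul_apply, hX, ih]
  have h := hpow (size m - 1)
  rw [twistOp_pow q hm, LinearMap.smul_apply, Module.End.one_apply] at h
  have h' : (evalAt q (Q m) ^ N m - 1) • v = 0 := by rw [sub_smul, h, one_smul, sub_self]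
  exact (smul_eq_zero.1 h').resolve_left (sub_ne_zero.2 hQ)

/-- Appending the letter `i` to a word. -/
def appendLetter {m : Fin n → ℕ} {i : Fin n} (hi : 0 < m i) (w : words (m - e i)) : words m :=
  ⟨w.1 ++ [i], by
    rw [mem_words, wordDegree_append, mem_words.1 w.2, wordDegree_cons]
    conv_rhs => rw [← sub_e_add_e hi]
    congr 1⟩

theorem moveOp_appendLetter {m : Fin n → ℕ} {i : Fin n} (hi : 0 < m i) {t : ℕ}
    (ht : t < size m - 1) (f : words (m - e i) →₀ K) :
    moveOp q m t (Finsupp.lmapDomain K K (appendLetter hi) f) =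
      Finsupp.lmapDomain K K (appendLetter hi) (moveOp q (m - e i) t f) := by
  have hsz := size_sub_e hi
  have : moveOp q m t ∘ₗ Finsupp.lmapDomain K K (appendLetter hi) =
      Finsupp.lmapDomain K K (appendLetter hi) ∘ₗ moveOp q (m - e i) t := by
    refine words_end_ext fun w => ?_
    obtain ⟨a, v, hw, hl, -⟩ := exists_cons_of_words (m := m - e i) (by omega) w
    have htv : t ≤ v.length := by omega
    rw [LinearMap.comp_apply, LinearMap.comp_apply, moveOp_single, map_smul,
      Finsupp.lmapDomain_apply, Finsupp.lmapDomain_apply, Finsupp.mapDomain_single,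
      Finsupp.mapDomain_single, moveOp_single]
    congr 1
    · simp [appendLetter, hw, List.take_append_of_le_length htv]
    · congr 1
      refine Subtype.ext ?_
      simp [appendLetter, moveWord, hw, List.take_append_of_le_length htv,
        List.drop_append_of_le_length htv]
  exact LinearMap.congr_fun this f

/-- For t < |m| - 1 the last letter stays in place, so the sum acts on words ending in i as the full
shuffle sum in degree m - e_i. Surjectivity, equivalent by finite dimension, can be checked on
single words. -/
theorem injective_sum_moveOp {m : Fin n → ℕ} (hm : 2 ≤ size m)
    (h : ∀ i, 0 < m i → Function.Injective (shuffleOp q (m - e i))) :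
    Function.Injective
      (∑ t ∈ Finset.range (size m - 1), moveOp q m t : Module.End K (words m →₀ K)) := by
  rw [LinearMap.injective_iff_surjective, ← LinearMap.range_eq_top, eq_top_iff,
    ← Finsupp.basisSingleOne.span_eq, Submodule.span_le]
  rintro _ ⟨w, rfl⟩
  rw [Finsupp.coe_basisSingleOne]
  obtain ⟨v, i, hw⟩ : ∃ v i, w.1 = v ++ [i] := by
    have hl := length_words w
    refine ⟨w.1.dropLast, w.1.getLast (by rw [← List.length_pos_iff]; omega), ?_⟩
    rw [List.dropLast_append_getLast]
  have hdeg := mem_words.1 w.2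
  have hdeg' : m = wordDegree v + e i := by
    rw [← hdeg, hw, wordDegree_append]
    congr 1
    funext j
    rw [wordDegree_cons]; simp [wordDegree]
  have hi : 0 < m i := by rw [hdeg']; simp [e]
  have hv : v ∈ words (m - e i) := by rw [mem_words, hdeg', add_tsub_cancel_right]
  obtain ⟨y, hy⟩ := LinearMap.injective_iff_surjective.1 (h i hi) (Finsupp.single ⟨v, hv⟩ 1)
  refine ⟨Finsupp.lmapDomain K K (appendLetter hi) y, ?_⟩
  rw [LinearMap.sum_apply, Finset.sum_congr rfl fun t ht =>
    moveOp_appendLetter q hi (Finset.mem_range.1 ht) y, ← map_sum, ← LinearMap.sum_apply,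
    ← size_sub_e hi]
  change Finsupp.lmapDomain K K (appendLetter hi) (shuffleOp q (m - e i) y) = _
  rw [hy, Finsupp.lmapDomain_apply, Finsupp.mapDomain_single]
  congr 1
  exact Subtype.ext hw.symm

end WordOperators

/-! ### Lyndon counts and n₁ ≤ n₂ in the special degrees. -/

section SmallDegrees

variable {n : ℕ}

/-- The degree `a e_i + b e_j`. -/
def pairDeg (i j : Fin n) (a b : ℕ) : Fin n → ℕ := a • e i + b • e j

theorem pairDeg_left {i j : Fin n} (hij : i ≠ j) (a b : ℕ) : pairDeg i j a b i = a := by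
  simp [pairDeg, e, hij]

theorem pairDeg_right {i j : Fin n} (hij : i ≠ j) (a b : ℕ) : pairDeg i j a b j = b := by
  simp [pairDeg, e, hij.symm]

theorem pairDeg_of_ne {i j k : Fin n} (hi : k ≠ i) (hj : k ≠ j) (a b : ℕ) :
    pairDeg i j a b k = 0 := by
  simp [pairDeg, e, hi, hj]

theorem pairDeg_comm (i j : Fin n) (a b : ℕ) : pairDeg i j a b = pairDeg j i b a :=
  add_comm _ _

theorem size_pairDeg (i j : Fin n) (a b : ℕ) : size (pairDeg i j a b) = a + b := by
  rw [pairDeg, size_add, size_nsmul, size_nsmul, size_e, size_e, Nat.mul_one, Nat.mul_one]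

theorem gcdVec_pairDeg {i j : Fin n} (hij : i ≠ j) (a b : ℕ) :
    gcdVec (pairDeg i j a b) = Nat.gcd a b := by
  refine Nat.dvd_antisymm (Nat.dvd_gcd ?_ ?_) (Finset.dvd_gcd fun k _ => ?_)
  · conv_rhs => rw [← pairDeg_left hij a b]
    exact gcdVec_dvd _ _
  · conv_rhs => rw [← pairDeg_right hij a b]
    exact gcdVec_dvd _ _
  · rw [pairDeg]
    exact dvd_add ((Nat.gcd_dvd_left a b).mul_right _) ((Nat.gcd_dvd_right a b).mul_right _)

theorem N_pairDeg {i j : Fin n} (hij : i ≠ j) (a b : ℕ) :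
    N (pairDeg i j a b) = Nat.gcd (Nat.gcd (a * (a - 1)) (b * (b - 1))) (a * b) := by
  have hi := pairDeg_left hij a b
  have hj := pairDeg_right hij a b
  refine Nat.dvd_antisymm (Nat.dvd_gcd (Nat.dvd_gcd ?_ ?_) ?_) (dvd_N (fun k => ?_) fun k l hkl => ?_)
  · simpa only [hi] using N_dvd_self (pairDeg i j a b) i
  · simpa only [hj] using N_dvd_self (pairDeg i j a b) j
  · simpa only [hi, hj] using N_dvd_of_ne (pairDeg i j a b) hij
  · rcases eq_or_ne k i with rfl | hki
    · rw [hi]; exact (Nat.gcd_dvd_left _ _).trans (Nat.gcd_dvd_left _ _)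
    rcases eq_or_ne k j with rfl | hkj
    · rw [hj]; exact (Nat.gcd_dvd_left _ _).trans (Nat.gcd_dvd_right _ _)
    rw [pairDeg_of_ne hki hkj, Nat.zero_mul]; exact dvd_zero _
  · by_cases hk : k = i ∨ k = j
    · by_cases hl : l = i ∨ l = j
      · have : pairDeg i j a b k * pairDeg i j a b l = a * b := by
          rcases hk with rfl | rfl <;> rcases hl with rfl | rfl
          · exact absurd rfl hkl
          · rw [hi, hj]
          · rw [hi, hj, Nat.mul_comm]
          · exact absurd rfl hkl
        rw [this]; exact Nat.gcd_dvd_right _ _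
      · rw [not_or] at hl
        rw [pairDeg_of_ne hl.1 hl.2, Nat.mul_zero]; exact dvd_zero _
    · rw [not_or] at hk
      rw [pairDeg_of_ne hk.1 hk.2, Nat.zero_mul]; exact dvd_zero _

theorem divVec_pairDeg {i j : Fin n} (hij : i ≠ j) (a b r : ℕ) :
    divVec (pairDeg i j a b) r = pairDeg i j (a / r) (b / r) := by
  funext k
  rw [divVec]
  rcases eq_or_ne k i with rfl | hki
  · rw [pairDeg_left hij, pairDeg_left hij]
  rcases eq_or_ne k j with rfl | hkj
  · rw [pairDeg_right hij, pairDeg_right hij]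
  rw [pairDeg_of_ne hki hkj, pairDeg_of_ne hki hkj, Nat.zero_div]

theorem pairDeg_sub_left {i j : Fin n} (hij : i ≠ j) (a b : ℕ) :
    pairDeg i j a b - e i = pairDeg i j (a - 1) b := by
  funext k
  rcases eq_or_ne k i with rfl | hki
  · rw [sub_e_self, pairDeg_left hij, pairDeg_left hij]
  rw [sub_e_of_ne _ hki]
  rcases eq_or_ne k j with rfl | hkj
  · rw [pairDeg_right hij, pairDeg_right hij]
  rw [pairDeg_of_ne hki hkj, pairDeg_of_ne hki hkj]

theorem pairDeg_sub_right {i j : Fin n} (hij : i ≠ j) (a b : ℕ) :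
    pairDeg i j a b - e j = pairDeg i j a (b - 1) := by
  rw [pairDeg_comm, pairDeg_sub_left hij.symm, pairDeg_comm]

theorem card_words_zero : (words (0 : Fin n → ℕ)).card = 1 := by
  rw [Finset.card_eq_one]
  refine ⟨[], Finset.ext fun w => ?_⟩
  rw [mem_words, Finset.mem_singleton]
  constructor
  · intro h
    rw [← List.length_eq_zero_iff, length_of_wordDegree h]; simp [size]
  · rintro rfl; funext k; simp [wordDegree]

theorem card_words_eq_sum {m : Fin n → ℕ} (hm : 0 < size m) :
    (words m).card = ∑ i : Fin n with 0 < m i, (words (m - e i)).card := by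
  simp only [Finset.card_eq_sum_ones]
  exact sum_words_cons hm fun _ => 1

theorem filter_pos_pairDeg {i j : Fin n} (hij : i ≠ j) {a b : ℕ} (ha : 0 < a) (hb : 0 < b) :
    (Finset.univ.filter fun k => 0 < pairDeg i j a b k) = {i, j} := by
  ext k
  simp only [Finset.mem_filter, Finset.mem_univ, true_and, Finset.mem_insert,
    Finset.mem_singleton]
  constructor
  · intro h
    by_contra hk
    rw [not_or] at hk
    rw [pairDeg_of_ne hk.1 hk.2] at h
    exact lt_irrefl _ h
  · rintro (rfl | rfl)
    · rwa [pairDeg_left hij]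
    · rwa [pairDeg_right hij]

theorem filter_pos_nsmul (i : Fin n) {a : ℕ} (ha : 0 < a) :
    (Finset.univ.filter fun k => 0 < (a • e i) k) = {i} := by
  ext k
  rcases eq_or_ne k i with rfl | hk
  · simpa [e] using ha
  · simp [e, hk]

theorem nsmul_e_sub (i : Fin n) (a : ℕ) : a • e i - e i = (a - 1) • e i := by
  funext k
  rcases eq_or_ne k i with rfl | hk <;> simp_all [e]

theorem card_words_nsmul_e (i : Fin n) (a : ℕ) : (words (a • e i)).card = 1 := by
  induction a with
  | zero => rw [zero_smul]; exact card_words_zero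
  | succ a ih =>
    rw [card_words_eq_sum (by rw [size_nsmul, size_e]; omega), filter_pos_nsmul i a.succ_pos,
      Finset.sum_singleton, nsmul_e_sub, Nat.add_sub_cancel, ih]

theorem card_words_pairDeg {i j : Fin n} (hij : i ≠ j) (a b : ℕ) :
    (words (pairDeg i j a b)).card = Nat.choose (a + b) a := by
  induction h : a + b generalizing a b with
  | zero =>
    obtain ⟨rfl, rfl⟩ : a = 0 ∧ b = 0 := by omega
    simpa [pairDeg] using card_words_zero (n := n)
  | succ s ih =>
    rcases Nat.eq_zero_or_pos a with rfl | ha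
    · simpa [pairDeg] using card_words_nsmul_e j b
    rcases Nat.eq_zero_or_pos b with rfl | hb
    · simp only [pairDeg, zero_smul, add_zero, card_words_nsmul_e]
      rw [← h, Nat.add_zero, Nat.choose_self]
    obtain ⟨a, rfl⟩ := Nat.exists_eq_succ_of_ne_zero ha.ne'
    rw [card_words_eq_sum (by rw [size_pairDeg]; omega), filter_pos_pairDeg hij ha hb,
      Finset.sum_pair hij, pairDeg_sub_left hij, pairDeg_sub_right hij, ih _ _ (by omega),
      ih _ _ (by omega), Nat.succ_eq_add_one, Nat.choose_succ_succ, Nat.add_sub_cancel]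

/-- Sorting all words by exponent determines the Lyndon numbers recursively; the explicit values
below come from this identity. -/
theorem sum_lyndonCount {m : Fin n → ℕ} (hm : 0 < size m) :
    ∑ r ∈ (gcdVec m).divisors, (size m / r) * lyndonCount (divVec m r) = (words m).card := by
  have := sum_words_exponent hm fun _ => 1
  simp only [Nat.one_mul] at this
  rw [← this, Finset.card_eq_sum_ones]

theorem sum_lyndonCount_pairDeg {i j : Fin n} (hij : i ≠ j) {a b : ℕ} (hab : 0 < a + b) :
    ∑ r ∈ (Nat.gcd a b).divisors, ((a + b) / r) * lyndonCount (pairDeg i j (a / r) (b / r)) =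
      Nat.choose (a + b) a := by
  have := sum_lyndonCount (m := pairDeg i j a b) (by rwa [size_pairDeg])
  rw [gcdVec_pairDeg hij, card_words_pairDeg hij, size_pairDeg] at this
  simpa only [divVec_pairDeg hij] using this

theorem lyndonCount_of_coprime {i j : Fin n} (hij : i ≠ j) {a b : ℕ} (hab : 0 < a + b)
    (h : Nat.gcd a b = 1) :
    (a + b) * lyndonCount (pairDeg i j a b) = Nat.choose (a + b) a := by
  simpa [h] using sum_lyndonCount_pairDeg hij hab

theorem gcdVec_nsmul_e (i : Fin n) (a : ℕ) : gcdVec (a • e i) = a := by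
  refine Nat.dvd_antisymm ?_ (Finset.dvd_gcd fun k _ => Dvd.intro _ rfl)
  have := gcdVec_dvd (a • e i) i
  simpa [e] using this

theorem divVec_nsmul_e (i : Fin n) (a r : ℕ) : divVec (a • e i) r = (a / r) • e i := by
  funext k
  rcases eq_or_ne k i with rfl | hk <;> simp_all [divVec, e]

/-- There is only one word of degree a e_i, so the divisor sum is 1, and its term r = a already
equals 1. -/
theorem lyndonCount_nsmul_e (i : Fin n) {a : ℕ} (ha : 0 < a) :
    lyndonCount (a • e i) = if a = 1 then 1 else 0 := by
  have h : ∀ {a}, 0 < a → ∑ r ∈ a.divisors, (a / r) * lyndonCount ((a / r) • e i) = 1 := by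
    intro a ha
    have := sum_lyndonCount (m := a • e i) (by rwa [size_nsmul, size_e, Nat.mul_one])
    rw [gcdVec_nsmul_e, card_words_nsmul_e, size_nsmul, size_e, Nat.mul_one] at this
    simpa only [divVec_nsmul_e] using this
  have h1 : lyndonCount (1 • e i) = 1 := by simpa using h Nat.one_pos
  split_ifs with h'
  · rw [h', h1]
  · have h2 := h ha
    rw [← Finset.add_sum_erase _ _ (Nat.mem_divisors_self a ha.ne'), Nat.div_self ha, h1,
      Nat.mul_one, Nat.add_eq_left, Finset.sum_eq_zero_iff] at h2
    have h3 := h2 1 (by simp [ha.ne', Ne.symm h'])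
    rw [Nat.div_one] at h3
    exact (Nat.mul_eq_zero.1 h3).resolve_left ha.ne'

theorem lyndonCount_one_pair {i j : Fin n} (hij : i ≠ j) (b : ℕ) :
    lyndonCount (pairDeg i j 1 b) = 1 := by
  have := lyndonCount_of_coprime hij (a := 1) (b := b) (by omega) (Nat.gcd_one_left b)
  rw [Nat.choose_one_right] at this
  exact Nat.eq_of_mul_eq_mul_left (by omega) (this.trans (Nat.mul_one _).symm)

theorem lyndonCount_two_pair {i j : Fin n} (hij : i ≠ j) (b : ℕ) :
    lyndonCount (pairDeg i j 2 b) = (b + 1) / 2 := by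
  obtain ⟨s, rfl | rfl⟩ := Nat.even_or_odd' b
  · have h := sum_lyndonCount_pairDeg hij (a := 2) (b := 2 * s) (by omega)
    rw [Nat.gcd_mul_right_right, Nat.Prime.divisors Nat.prime_two,
      Finset.sum_pair (by norm_num)] at h
    simp only [Nat.div_one, Nat.div_self (show 0 < 2 by norm_num),
      Nat.mul_div_cancel_left s (show 0 < 2 by norm_num), lyndonCount_one_pair hij,
      Nat.mul_one] at h
    have h1 : Nat.choose (2 + 2 * s) 2 = (s + 1) * (2 * s + 1) := by
      rw [Nat.choose_two_right, show (2 + 2 * s) * (2 + 2 * s - 1) = 2 * ((s + 1) * (2 * s + 1)) by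
        rw [show 2 + 2 * s - 1 = 2 * s + 1 by omega]; ring, Nat.mul_div_cancel_left _ two_pos]
    rw [h1, show (2 + 2 * s) / 2 = s + 1 by omega] at h
    have h2 : (s + 1) * (2 * lyndonCount (pairDeg i j 2 (2 * s)) + 1) = (s + 1) * (2 * s + 1) := by
      rw [← h]; ring
    have := Nat.eq_of_mul_eq_mul_left s.succ_pos h2
    omega
  · have h := lyndonCount_of_coprime hij (a := 2) (b := 2 * s + 1) (by omega) (by simp)
    have h1 : Nat.choose (2 + (2 * s + 1)) 2 = (2 + (2 * s + 1)) * (s + 1) := by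
      rw [Nat.choose_two_right, show (2 + (2 * s + 1)) * (2 + (2 * s + 1) - 1) =
        2 * ((2 + (2 * s + 1)) * (s + 1)) by
          rw [show 2 + (2 * s + 1) - 1 = 2 * (s + 1) by omega]; ring,
        Nat.mul_div_cancel_left _ two_pos]
    rw [h1] at h
    have := Nat.eq_of_mul_eq_mul_left (by omega) h
    omega

variable {K : Type*} [Field K] (q : Fin n → Fin n → K)

/-- The number of rotation classes of words of degree `l` counted in `n₁(q)` and `n₂(q)`. -/
noncomputable def cyclicSum (m l : Fin n → ℕ) : ℕ :=
  ∑ r ∈ (gcdVec l).divisors with r ∣ dPrime q m, lyndonCount (divVec l r)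

open Classical in
theorem cyclicSum_pairDeg {m : Fin n → ℕ} (hm : 2 ≤ size m) (hQ : evalAt q (Q m) ^ N m = 1)
    {i j : Fin n} (hij : i ≠ j) {a b : ℕ} (h : Nat.gcd a b ∣ N m) :
    cyclicSum q m (pairDeg i j a b) = ∑ r ∈ (Nat.gcd a b).divisors,
      if evalAt q (Q m) ^ (N m / r) = 1 then lyndonCount (pairDeg i j (a / r) (b / r)) else 0 := by
  rw [cyclicSum, gcdVec_pairDeg hij, Finset.sum_filter]
  refine Finset.sum_congr rfl fun r hr => ?_
  simp only [dvd_dPrime_iff q hm hQ ((Nat.dvd_of_mem_divisors hr).trans h), divVec_pairDeg hij]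

open Classical in
theorem cyclicSum_nsmul_e {m : Fin n → ℕ} (hm : 2 ≤ size m) (hQ : evalAt q (Q m) ^ N m = 1)
    (i : Fin n) {a : ℕ} (ha : 0 < a) (h : a ∣ N m) :
    cyclicSum q m (a • e i) = if evalAt q (Q m) ^ (N m / a) = 1 then 1 else 0 := by
  rw [cyclicSum, gcdVec_nsmul_e, Finset.sum_filter, Finset.sum_eq_single a]
  · simp only [dvd_dPrime_iff q hm hQ h]
    rw [divVec_nsmul_e, Nat.div_self ha,
      lyndonCount_nsmul_e i Nat.one_pos, if_pos rfl]
  · intro r hr hra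
    have hr := Nat.dvd_of_mem_divisors hr
    have hpos : 0 < a / r := Nat.div_pos (Nat.le_of_dvd ha hr) (Nat.pos_of_dvd_of_pos hr ha)
    have h1 : a / r ≠ 1 := fun h1 => by
      have := Nat.div_mul_cancel hr
      rw [h1] at this
      omega
    rw [divVec_nsmul_e, lyndonCount_nsmul_e i hpos, if_neg h1, ite_self]
  · intro h'; exact absurd (Nat.mem_divisors_self a ha.ne') h'

theorem n₁_pairDeg {i j : Fin n} (hij : i ≠ j) {a b : ℕ} (ha : 0 < a) (hb : 0 < b) :
    n₁ q (pairDeg i j a b) = cyclicSum q (pairDeg i j a b) (pairDeg i j (a - 1) b) +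
      cyclicSum q (pairDeg i j a b) (pairDeg i j a (b - 1)) := by
  rw [n₁, filter_pos_pairDeg hij ha hb, Finset.sum_pair hij, pairDeg_sub_left hij,
    pairDeg_sub_right hij]
  rfl

theorem evalAt_Q_pairDeg {i j : Fin n} (hij : i ≠ j) (a b : ℕ) :
    evalAt q (Q (pairDeg i j a b)) =
      q i i ^ (a * (a - 1) / N (pairDeg i j a b)) * q j j ^ (b * (b - 1) / N (pairDeg i j a b)) *
        (q i j * q j i) ^ (a * b / N (pairDeg i j a b)) := by
  rw [evalAt_Q]
  have hout : ∀ k, k ≠ i ∧ k ≠ j → ∏ l, q k l ^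
      ((pairDeg i j a b - e k) l * pairDeg i j a b k / N (pairDeg i j a b)) = 1 := by
    intro k hk
    refine Finset.prod_eq_one fun l _ => ?_
    rw [pairDeg_of_ne hk.1 hk.2, Nat.mul_zero, Nat.zero_div, pow_zero]
  rw [Fintype.prod_eq_mul i j hij hout]
  rw [Fintype.prod_eq_mul i j hij, Fintype.prod_eq_mul i j hij]
  · simp only [pairDeg_sub_left hij, pairDeg_sub_right hij, pairDeg_left hij, pairDeg_right hij]
    rw [Nat.mul_comm (a - 1), Nat.mul_comm b a, Nat.mul_comm (b - 1)]
    ring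
  · intro k hk
    rw [pairDeg_sub_right hij, pairDeg_of_ne hk.1 hk.2, Nat.zero_mul, Nat.zero_div, pow_zero]
  · intro k hk
    rw [pairDeg_sub_left hij, pairDeg_of_ne hk.1 hk.2, Nat.zero_mul, Nat.zero_div, pow_zero]

theorem N_nsmul_e (i : Fin n) (a : ℕ) : N (a • e i) = a * (a - 1) := by
  have hi : (a • e i) i = a := by simp [e]
  refine Nat.dvd_antisymm ?_ (dvd_N (fun k => ?_) fun k l hkl => ?_)
  · simpa only [hi] using N_dvd_self (a • e i) i
  · rcases eq_or_ne k i with rfl | hk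
    · rw [hi]
    · simp [e, hk]
  · rcases eq_or_ne k i with rfl | hk
    · simp [e, hkl.symm]
    · simp [e, hk]

theorem evalAt_Q_nsmul_e (i : Fin n) {a : ℕ} (ha : 2 ≤ a) : evalAt q (Q (a • e i)) = q i i := by
  have hi : (a • e i) i = a := by simp [e]
  rw [evalAt_Q, Fintype.prod_eq_single i, Fintype.prod_eq_single i]
  · rw [N_nsmul_e, sub_e_self, hi, Nat.mul_comm, Nat.div_self, pow_one]
    exact Nat.mul_pos (by omega) (by omega)
  · intro k hk
    rw [sub_e_of_ne _ hk]; simp [e, hk]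
  · intro k hk
    refine Finset.prod_eq_one fun l _ => ?_
    simp [e, hk]

/-- Here n₁ is 1 or 0 according as q_ii^a = 1 or not, and n₂ likewise with q_ii^{a-1}. If (a)_{q_ii}
≠ 0, the first equation forces q_ii = 1. -/
theorem n₁_le_n₂_nsmul_e (i : Fin n) {a : ℕ} (ha : 2 ≤ a) (hQ : q i i ^ (a * (a - 1)) = 1)
    (hP : qInt a (q i i) ≠ 0) : n₁ q (a • e i) ≤ n₂ q (a • e i) := by
  classical
  have hm : 2 ≤ size (a • e i) := by rwa [size_nsmul, size_e, Nat.mul_one]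
  have hQ' : evalAt q (Q (a • e i)) ^ N (a • e i) = 1 := by
    rwa [evalAt_Q_nsmul_e q i ha, N_nsmul_e]
  have h1 : n₁ q (a • e i) = cyclicSum q (a • e i) ((a - 1) • e i) := by
    rw [n₁, filter_pos_nsmul i (by omega), Finset.sum_singleton, nsmul_e_sub]; rfl
  have h2 : n₂ q (a • e i) = cyclicSum q (a • e i) (a • e i) := rfl
  rw [h1, h2, cyclicSum_nsmul_e q hm hQ' i (by omega) (by rw [N_nsmul_e]; exact dvd_mul_left _ _),
    cyclicSum_nsmul_e q hm hQ' i (by omega) (by rw [N_nsmul_e]; exact dvd_mul_right _ _),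
    evalAt_Q_nsmul_e q i ha, N_nsmul_e, Nat.mul_div_cancel _ (by omega),
    Nat.mul_div_cancel_left _ (by omega)]
  by_cases h : q i i ^ a = 1
  · have hg := geom_sum_mul (q i i) a
    rw [h, sub_self] at hg
    have hq := sub_eq_zero.1 ((mul_eq_zero.1 hg).resolve_left hP)
    simp [hq]
  · simp [h]

/-- The degree b e_j would contribute to n₁ only if Q = 1; what remains is 1 on both sides. -/
theorem n₁_le_n₂_one {i j : Fin n} (hij : i ≠ j) {b : ℕ} (hb : 0 < b)
    (hQ : evalAt q (Q (pairDeg i j 1 b)) ^ N (pairDeg i j 1 b) = 1)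
    (hP : evalAt q (Q (pairDeg i j 1 b)) ≠ 1) :
    n₁ q (pairDeg i j 1 b) ≤ n₂ q (pairDeg i j 1 b) := by
  have hm : 2 ≤ size (pairDeg i j 1 b) := by rw [size_pairDeg]; omega
  have hN : N (pairDeg i j 1 b) = b := by
    rw [N_pairDeg hij]; simp
  have h0 : pairDeg i j (1 - 1) b = b • e j := by simp [pairDeg]
  have h2 : n₂ q (pairDeg i j 1 b) = cyclicSum q (pairDeg i j 1 b) (pairDeg i j 1 b) := rfl
  rw [n₁_pairDeg q hij one_pos hb, h2, h0, cyclicSum_nsmul_e q hm hQ j hb (by rw [hN]),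
    cyclicSum_pairDeg q hm hQ hij (by simp), cyclicSum_pairDeg q hm hQ hij (by simp)]
  simp [lyndonCount_one_pair hij, hN, Nat.div_self hb, hP]

theorem N_two {i j : Fin n} (hij : i ≠ j) (b : ℕ) : N (pairDeg i j 2 b) = 2 := by
  rw [N_pairDeg hij]
  have h := Nat.even_mul_pred_self b
  simp [Nat.gcd_eq_left h.two_dvd]

/-- Here N = 2, so Q = ±1. For even b = 2s + 2, Q = 1 and the term r = 2 enters n₂: both numbers are
s + 2. For odd b = 2s + 1, Q ≠ 1 removes the term r = 2 from n₁: both are s + 1. -/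
theorem n₁_le_n₂_two {i j : Fin n} (hij : i ≠ j) {b : ℕ} (hb : 0 < b)
    (hQ : evalAt q (Q (pairDeg i j 2 b)) ^ N (pairDeg i j 2 b) = 1)
    (hP : 1 + (-1) ^ b * evalAt q (Q (pairDeg i j 2 b)) ≠ 0) :
    n₁ q (pairDeg i j 2 b) ≤ n₂ q (pairDeg i j 2 b) := by
  have hm : 2 ≤ size (pairDeg i j 2 b) := by rw [size_pairDeg]; omega
  have hN := N_two hij b
  have h2 : n₂ q (pairDeg i j 2 b) = cyclicSum q (pairDeg i j 2 b) (pairDeg i j 2 b) := rfl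
  rw [n₁_pairDeg q hij two_pos hb, h2, cyclicSum_pairDeg q hm hQ hij (by simp),
    cyclicSum_pairDeg q hm hQ hij (by rw [hN]; exact Nat.gcd_dvd_left _ _),
    cyclicSum_pairDeg q hm hQ hij (by rw [hN]; exact Nat.gcd_dvd_left _ _)]
  rw [hN] at hQ ⊢
  generalize evalAt q (Q (pairDeg i j 2 b)) = z at *
  obtain ⟨s, rfl | rfl⟩ := Nat.even_or_odd' b
  · obtain ⟨s, rfl⟩ := Nat.exists_eq_succ_of_ne_zero (show s ≠ 0 by omega)
    have hz : z = 1 := by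
      rw [Even.neg_one_pow (even_two_mul _), one_mul] at hP
      have h : (z - 1) * (1 + z) = 0 := by linear_combination hQ
      exact sub_eq_zero.1 ((mul_eq_zero.1 h).resolve_right hP)
    have hg : Nat.gcd 2 (2 * s.succ - 1) = 1 := by
      rw [show 2 * s.succ - 1 = 2 * s + 1 by omega]; simp
    rw [hg, Nat.gcd_mul_right_right, Nat.Prime.divisors Nat.prime_two,
      Finset.sum_pair (by norm_num)]
    simp [hz, lyndonCount_one_pair hij, lyndonCount_two_pair hij]
    omega
  · have hz : z ≠ 1 := by
      rintro rfl
      rw [Odd.neg_one_pow (odd_two_mul_add_one _)] at hP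
      exact hP (by ring)
    rw [show 2 * s + 1 - 1 = 2 * s by omega, Nat.gcd_mul_right_right,
      Nat.Prime.divisors Nat.prime_two, Finset.sum_pair (by norm_num)]
    simp [hz, hQ, lyndonCount_one_pair hij, lyndonCount_two_pair hij]
    omega

theorem divisors_three : Nat.divisors 3 = {1, 3} := Nat.Prime.divisors Nat.prime_three

theorem divisors_four : Nat.divisors 4 = {1, 2, 4} := by decide

theorem lyndonCount_three_two {i j : Fin n} (hij : i ≠ j) : lyndonCount (pairDeg i j 3 2) = 2 := by
  rw [pairDeg_comm, lyndonCount_two_pair hij.symm]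

theorem lyndonCount_three_three {i j : Fin n} (hij : i ≠ j) :
    lyndonCount (pairDeg i j 3 3) = 3 := by
  have h := sum_lyndonCount_pairDeg hij (a := 3) (b := 3) (by omega)
  rw [Nat.gcd_self, divisors_three, Finset.sum_pair (by norm_num)] at h
  norm_num [lyndonCount_one_pair hij, Nat.choose] at h
  omega

theorem lyndonCount_three_four {i j : Fin n} (hij : i ≠ j) :
    lyndonCount (pairDeg i j 3 4) = 5 := by
  have h := lyndonCount_of_coprime hij (a := 3) (b := 4) (by omega) (by norm_num)
  norm_num [Nat.choose] at h
  omega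

theorem lyndonCount_three_five {i j : Fin n} (hij : i ≠ j) :
    lyndonCount (pairDeg i j 3 5) = 7 := by
  have h := lyndonCount_of_coprime hij (a := 3) (b := 5) (by omega) (by norm_num)
  norm_num [Nat.choose] at h
  omega

theorem lyndonCount_three_six {i j : Fin n} (hij : i ≠ j) :
    lyndonCount (pairDeg i j 3 6) = 9 := by
  have h := sum_lyndonCount_pairDeg hij (a := 3) (b := 6) (by omega)
  rw [show Nat.gcd 3 6 = 3 by norm_num, divisors_three, Finset.sum_pair (by norm_num)] at h
  norm_num [lyndonCount_one_pair hij, Nat.choose] at h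
  omega

theorem lyndonCount_four_three {i j : Fin n} (hij : i ≠ j) :
    lyndonCount (pairDeg i j 4 3) = 5 := by
  rw [pairDeg_comm, lyndonCount_three_four hij.symm]

theorem lyndonCount_four_four {i j : Fin n} (hij : i ≠ j) :
    lyndonCount (pairDeg i j 4 4) = 8 := by
  have h := sum_lyndonCount_pairDeg hij (a := 4) (b := 4) (by omega)
  rw [Nat.gcd_self, divisors_four, Finset.sum_insert (by norm_num),
    Finset.sum_pair (by norm_num)] at h
  norm_num [lyndonCount_one_pair hij, lyndonCount_two_pair hij, Nat.choose] at h
  omega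

theorem N_three_three {i j : Fin n} (hij : i ≠ j) : N (pairDeg i j 3 3) = 3 := by
  rw [N_pairDeg hij]; norm_num

theorem N_three_four {i j : Fin n} (hij : i ≠ j) : N (pairDeg i j 3 4) = 6 := by
  rw [N_pairDeg hij]; norm_num

theorem N_three_six {i j : Fin n} (hij : i ≠ j) : N (pairDeg i j 3 6) = 6 := by
  rw [N_pairDeg hij]; norm_num

theorem N_four_four {i j : Fin n} (hij : i ≠ j) : N (pairDeg i j 4 4) = 4 := by
  rw [N_pairDeg hij]; norm_num

/-- Only Q = 1 remains, and then n₁ = 2 + 2 and n₂ = 3 + 1. -/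
theorem n₁_le_n₂_three_three {i j : Fin n} (hij : i ≠ j)
    (hQ : evalAt q (Q (pairDeg i j 3 3)) ^ N (pairDeg i j 3 3) = 1)
    (hP : qInt 3 (evalAt q (Q (pairDeg i j 3 3))) ≠ 0) :
    n₁ q (pairDeg i j 3 3) ≤ n₂ q (pairDeg i j 3 3) := by
  have hm : 2 ≤ size (pairDeg i j 3 3) := by rw [size_pairDeg]; omega
  have hN := N_three_three hij
  have h2 : n₂ q (pairDeg i j 3 3) = cyclicSum q (pairDeg i j 3 3) (pairDeg i j 3 3) := rfl
  rw [n₁_pairDeg q hij (by norm_num) (by norm_num), h2,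
    cyclicSum_pairDeg q hm hQ hij (by norm_num), cyclicSum_pairDeg q hm hQ hij (by norm_num),
    cyclicSum_pairDeg q hm hQ hij (by rw [hN]; norm_num)]
  rw [hN] at hQ ⊢
  generalize evalAt q (Q (pairDeg i j 3 3)) = z at *
  have hz : z = 1 := by
    have hg := geom_sum_mul z 3
    rw [hQ, sub_self] at hg
    exact sub_eq_zero.1 ((mul_eq_zero.1 hg).resolve_left hP)
  rw [Nat.gcd_self, divisors_three, Finset.sum_pair (by norm_num)]
  norm_num [hz, lyndonCount_one_pair hij, lyndonCount_two_pair hij, lyndonCount_three_two hij,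
    lyndonCount_three_three hij]

/-- The terms r = 2 and r = 3 of n₁ require Q^3 = 1 and Q^2 = 1, both excluded; then n₁ = 2 + 3 and
n₂ = 5. -/
theorem n₁_le_n₂_three_four {i j : Fin n} (hij : i ≠ j)
    (hQ : evalAt q (Q (pairDeg i j 3 4)) ^ N (pairDeg i j 3 4) = 1)
    (hP : (1 - evalAt q (Q (pairDeg i j 3 4)) ^ 2) * qInt 3 (evalAt q (Q (pairDeg i j 3 4))) ≠ 0) :
    n₁ q (pairDeg i j 3 4) ≤ n₂ q (pairDeg i j 3 4) := by
  have hm : 2 ≤ size (pairDeg i j 3 4) := by rw [size_pairDeg]; omega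
  have hN := N_three_four hij
  have h2 : n₂ q (pairDeg i j 3 4) = cyclicSum q (pairDeg i j 3 4) (pairDeg i j 3 4) := rfl
  rw [n₁_pairDeg q hij (by norm_num) (by norm_num), h2,
    cyclicSum_pairDeg q hm hQ hij (by rw [hN]; norm_num),
    cyclicSum_pairDeg q hm hQ hij (by rw [hN]; norm_num),
    cyclicSum_pairDeg q hm hQ hij (by rw [hN]; norm_num)]
  rw [hN] at hQ ⊢
  generalize evalAt q (Q (pairDeg i j 3 4)) = z at *
  have hz2 : z ^ 2 ≠ 1 := fun h => hP (by rw [h, sub_self, zero_mul])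
  have hz3 : z ^ 3 ≠ 1 := fun h => by
    have hg := geom_sum_mul z 3
    rw [h, sub_self] at hg
    have hz := sub_eq_zero.1 ((mul_eq_zero.1 hg).resolve_left (right_ne_zero_of_mul hP))
    exact hz2 (by rw [hz, one_pow])
  norm_num [hQ, hz2, hz3, lyndonCount_two_pair hij, lyndonCount_three_three hij, divisors_three,
    Nat.Prime.divisors Nat.prime_two, lyndonCount_three_four hij]

/-- Only Q = -1 remains. The term r = 2 of n₁ is excluded, while r = 3 enters n₂: n₁ = 3 + 7 and n₂
= 9 + 1. -/
theorem n₁_le_n₂_three_six {i j : Fin n} (hij : i ≠ j)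
    (hQ : evalAt q (Q (pairDeg i j 3 6)) ^ N (pairDeg i j 3 6) = 1)
    (hP : (1 - evalAt q (Q (pairDeg i j 3 6))) *
      qInt 3 (evalAt q (Q (pairDeg i j 3 6)) ^ 2) ≠ 0) :
    n₁ q (pairDeg i j 3 6) ≤ n₂ q (pairDeg i j 3 6) := by
  have hm : 2 ≤ size (pairDeg i j 3 6) := by rw [size_pairDeg]; omega
  have hN := N_three_six hij
  have h2 : n₂ q (pairDeg i j 3 6) = cyclicSum q (pairDeg i j 3 6) (pairDeg i j 3 6) := rfl
  rw [n₁_pairDeg q hij (by norm_num) (by norm_num), h2,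
    cyclicSum_pairDeg q hm hQ hij (by rw [hN]; norm_num),
    cyclicSum_pairDeg q hm hQ hij (by rw [hN]; norm_num),
    cyclicSum_pairDeg q hm hQ hij (by rw [hN]; norm_num)]
  rw [hN] at hQ ⊢
  generalize evalAt q (Q (pairDeg i j 3 6)) = z at *
  have hz1 : z ≠ 1 := fun h => hP (by rw [h, sub_self, zero_mul])
  have hz2 : z ^ 2 = 1 := by
    have hg := geom_sum_mul (z ^ 2) 3
    rw [← pow_mul, hQ, sub_self] at hg
    exact sub_eq_zero.1 ((mul_eq_zero.1 hg).resolve_left (right_ne_zero_of_mul hP))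
  have hz3 : z ^ 3 ≠ 1 := by rwa [pow_succ, hz2, one_mul]
  norm_num [hQ, hz2, hz3, lyndonCount_one_pair hij, lyndonCount_two_pair hij,
    lyndonCount_three_five hij, divisors_three, Nat.Prime.divisors Nat.prime_two,
    lyndonCount_three_six hij]

/-- Only Q = 1 remains, and then n₁ = 5 + 5 and n₂ = 8 + 1 + 1. -/
theorem n₁_le_n₂_four_four {i j : Fin n} (hij : i ≠ j)
    (hQ : evalAt q (Q (pairDeg i j 4 4)) ^ N (pairDeg i j 4 4) = 1)
    (hP : (1 + evalAt q (Q (pairDeg i j 4 4))) *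
      (1 + evalAt q (Q (pairDeg i j 4 4)) ^ 2) ≠ 0) :
    n₁ q (pairDeg i j 4 4) ≤ n₂ q (pairDeg i j 4 4) := by
  have hm : 2 ≤ size (pairDeg i j 4 4) := by rw [size_pairDeg]; omega
  have hN := N_four_four hij
  have h2 : n₂ q (pairDeg i j 4 4) = cyclicSum q (pairDeg i j 4 4) (pairDeg i j 4 4) := rfl
  rw [n₁_pairDeg q hij (by norm_num) (by norm_num), h2,
    cyclicSum_pairDeg q hm hQ hij (by norm_num),
    cyclicSum_pairDeg q hm hQ hij (by norm_num),
    cyclicSum_pairDeg q hm hQ hij (by rw [hN]; norm_num)]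
  rw [hN] at hQ ⊢
  generalize evalAt q (Q (pairDeg i j 4 4)) = z at *
  have hz : z = 1 := by
    have h : (z - 1) * ((1 + z) * (1 + z ^ 2)) = 0 := by linear_combination hQ
    exact sub_eq_zero.1 ((mul_eq_zero.1 h).resolve_right hP)
  rw [Nat.gcd_self, divisors_four, Finset.sum_insert (by norm_num),
    Finset.sum_pair (by norm_num)]
  norm_num [hz, lyndonCount_one_pair hij, lyndonCount_two_pair hij, lyndonCount_three_four hij,
    lyndonCount_four_three hij, lyndonCount_four_four hij]

end SmallDegrees

/-! ### The polynomials P_m control injectivity. -/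

section Criterion

variable {n : ℕ} {K : Type*} [Field K] (q : Fin n → Fin n → K)

/-- A polynomial `f` detects the degree `m` if its vanishing at `q` forces `Q_m(q)^{N(m)} = 1`, and
if conversely `n₁(q) ≤ n₂(q)` whenever `Q_m(q)^{N(m)} = 1` and `f` does not vanish at `q`. -/
def Detects (m : Fin n → ℕ) (f : MvPolynomial (Fin n × Fin n) ℤ) : Prop :=
  (evalAt q f = 0 → evalAt q (Q m) ^ N m = 1) ∧
    (evalAt q (Q m) ^ N m = 1 → evalAt q f ≠ 0 → n₁ q m ≤ n₂ q m)

theorem detects_nsmul_e (i : Fin n) {a : ℕ} (ha : 2 ≤ a) :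
    Detects q (a • e i) (qInt a (p i i)) := by
  have hf : evalAt q (qInt a (p i i)) = qInt a (q i i) := by
    simp [evalAt, p, qInt]
  rw [Detects, hf, evalAt_Q_nsmul_e q i ha, N_nsmul_e]
  refine ⟨fun h => ?_, n₁_le_n₂_nsmul_e q i ha⟩
  have hg := geom_sum_mul (q i i) a
  rw [show ∑ t ∈ Finset.range a, q i i ^ t = 0 from h, zero_mul] at hg
  rw [pow_mul, sub_eq_zero.1 hg.symm, one_pow]

theorem detects_one {i j : Fin n} (hij : i ≠ j) {b : ℕ} (hb : 0 < b) :
    Detects q (pairDeg i j 1 b) (1 - p j j ^ (b - 1) * (p i j * p j i)) := by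
  have hN : N (pairDeg i j 1 b) = b := by rw [N_pairDeg hij]; simp
  have hf : evalAt q (1 - p j j ^ (b - 1) * (p i j * p j i)) =
      1 - evalAt q (Q (pairDeg i j 1 b)) := by
    rw [evalAt_Q_pairDeg q hij, hN, Nat.mul_div_cancel_left _ hb]
    simp [evalAt, p, Nat.div_self hb]
  rw [Detects, hf]
  refine ⟨fun h => ?_, fun hQ h => n₁_le_n₂_one q hij hb hQ fun h' => h ?_⟩
  · rw [← sub_eq_zero.1 h, one_pow]
  · rw [h', sub_self]

theorem detects_two {i j : Fin n} (hij : i ≠ j) {b : ℕ} (hb : 0 < b) :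
    Detects q (pairDeg i j 2 b)
      (1 + p j j ^ (b * (b - 1) / 2) * (-(p i j * p j i)) ^ b * p i i) := by
  have hf : evalAt q (1 + p j j ^ (b * (b - 1) / 2) * (-(p i j * p j i)) ^ b * p i i) =
      1 + (-1) ^ b * evalAt q (Q (pairDeg i j 2 b)) := by
    rw [evalAt_Q_pairDeg q hij, N_two hij, Nat.mul_div_cancel_left _ two_pos, neg_pow]
    simp [evalAt, p]
    ring
  rw [Detects, hf]
  refine ⟨fun h => ?_, n₁_le_n₂_two q hij hb⟩
  rw [N_two hij]
  have h1 : (-1 : K) ^ b * (-1) ^ b = 1 := by rw [← mul_pow]; simp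
  linear_combination ((-1) ^ b * evalAt q (Q (pairDeg i j 2 b)) - 1) * h -
    evalAt q (Q (pairDeg i j 2 b)) ^ 2 * h1

theorem detects_three_three {i j : Fin n} (hij : i ≠ j) :
    Detects q (pairDeg i j 3 3) (qInt 3 (p i i ^ 2 * (p i j * p j i) ^ 3 * p j j ^ 2)) := by
  have hf : evalAt q (qInt 3 (p i i ^ 2 * (p i j * p j i) ^ 3 * p j j ^ 2)) =
      qInt 3 (evalAt q (Q (pairDeg i j 3 3))) := by
    rw [evalAt_Q_pairDeg q hij, N_three_three hij]
    simp [evalAt, p, qInt, Finset.sum_range_succ]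
    ring
  rw [Detects, hf]
  refine ⟨fun h => ?_, n₁_le_n₂_three_three q hij⟩
  rw [N_three_three hij]
  simp only [qInt, Finset.sum_range_succ, Finset.sum_range_zero] at h
  linear_combination (evalAt q (Q (pairDeg i j 3 3)) - 1) * h

theorem detects_three_four {i j : Fin n} (hij : i ≠ j) :
    Detects q (pairDeg i j 3 4) ((1 - p i i ^ 2 * (p i j * p j i) ^ 4 * p j j ^ 4) *
      qInt 3 (p i i * (p i j * p j i) ^ 2 * p j j ^ 2)) := by
  have hf : evalAt q ((1 - p i i ^ 2 * (p i j * p j i) ^ 4 * p j j ^ 4) *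
      qInt 3 (p i i * (p i j * p j i) ^ 2 * p j j ^ 2)) =
      (1 - evalAt q (Q (pairDeg i j 3 4)) ^ 2) * qInt 3 (evalAt q (Q (pairDeg i j 3 4))) := by
    rw [evalAt_Q_pairDeg q hij, N_three_four hij]
    simp [evalAt, p, qInt, Finset.sum_range_succ]
    ring
  rw [Detects, hf]
  refine ⟨fun h => ?_, n₁_le_n₂_three_four q hij⟩
  rw [N_three_four hij]
  generalize evalAt q (Q (pairDeg i j 3 4)) = z at *
  simp only [qInt, Finset.sum_range_succ, Finset.sum_range_zero] at h
  -- The cofactor comes from 1 - z^6 = (1 - z^2)(1 + z + z^2)(1 - z + z^2).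
  linear_combination -(1 - z + z ^ 2) * h

theorem detects_three_six {i j : Fin n} (hij : i ≠ j) :
    Detects q (pairDeg i j 3 6) ((1 - p i i * (p i j * p j i) ^ 3 * p j j ^ 5) *
      qInt 3 (p i i ^ 2 * (p i j * p j i) ^ 6 * p j j ^ 10)) := by
  have hf : evalAt q ((1 - p i i * (p i j * p j i) ^ 3 * p j j ^ 5) *
      qInt 3 (p i i ^ 2 * (p i j * p j i) ^ 6 * p j j ^ 10)) =
      (1 - evalAt q (Q (pairDeg i j 3 6))) * qInt 3 (evalAt q (Q (pairDeg i j 3 6)) ^ 2) := by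
    rw [evalAt_Q_pairDeg q hij, N_three_six hij]
    simp [evalAt, p, qInt, Finset.sum_range_succ]
    ring
  rw [Detects, hf]
  refine ⟨fun h => ?_, n₁_le_n₂_three_six q hij⟩
  rw [N_three_six hij]
  generalize evalAt q (Q (pairDeg i j 3 6)) = z at *
  simp only [qInt, Finset.sum_range_succ, Finset.sum_range_zero] at h
  linear_combination -(1 + z) * h

theorem detects_four_four {i j : Fin n} (hij : i ≠ j) :
    Detects q (pairDeg i j 4 4) ((1 + p i i ^ 3 * (p i j * p j i) ^ 4 * p j j ^ 3) *
      (1 + p i i ^ 6 * (p i j * p j i) ^ 8 * p j j ^ 6)) := by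
  have hf : evalAt q ((1 + p i i ^ 3 * (p i j * p j i) ^ 4 * p j j ^ 3) *
      (1 + p i i ^ 6 * (p i j * p j i) ^ 8 * p j j ^ 6)) =
      (1 + evalAt q (Q (pairDeg i j 4 4))) * (1 + evalAt q (Q (pairDeg i j 4 4)) ^ 2) := by
    rw [evalAt_Q_pairDeg q hij, N_four_four hij]
    simp [evalAt, p]
    ring
  rw [Detects, hf]
  refine ⟨fun h => ?_, n₁_le_n₂_four_four q hij⟩
  rw [N_four_four hij]
  generalize evalAt q (Q (pairDeg i j 4 4)) = z at *
  linear_combination (z - 1) * h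

/-- The polynomial evaluates to 1 - Q^N, so the second half of `Detects` is vacuous. -/
theorem detects_generic {m : Fin n → ℕ} (hm : 2 ≤ size m) :
    Detects q m (1 - (∏ i, p i i ^ (m i * (m i - 1))) *
      ∏ a : Fin n × Fin n with a.1 < a.2, (p a.1 a.2 * p a.2 a.1) ^ (m a.1 * m a.2)) := by
  have hf : evalAt q (1 - (∏ i, p i i ^ (m i * (m i - 1))) *
      ∏ a : Fin n × Fin n with a.1 < a.2, (p a.1 a.2 * p a.2 a.1) ^ (m a.1 * m a.2)) =
      1 - evalAt q (Q m) ^ N m := by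
    have h := evalAt_Q_pow q hm (one_dvd _)
    simp only [Nat.div_one] at h
    rw [h, prod_pairs_eq]
    simp only [evalAt, p, map_sub, map_one, map_mul, map_prod, map_pow, MvPolynomial.aeval_X]
    congr 2
    · exact Finset.prod_congr rfl fun a _ => by rw [sub_e_self, Nat.mul_comm]
    · refine Finset.prod_congr rfl fun a ha => ?_
      have ha := (Finset.mem_filter.1 ha).2.ne
      rw [sub_e_of_ne m ha, sub_e_of_ne m ha.symm, Nat.mul_comm (m a.2), mul_pow]
  rw [Detects, hf]
  exact ⟨fun h => (sub_eq_zero.1 h).symm, fun h h' => absurd (by rw [h, sub_self]) h'⟩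

/-- The indices inside `P` are obtained by choice; only their specification matters, so they are
generalized before m is substituted. -/
theorem detects_P {m : Fin n → ℕ} (hm : 2 ≤ size m) : Detects q m (P m) := by
  rw [P]
  split_ifs with h₁ h₂ h₃ h₄ h₅ h₆ h₇
  · have hs := h₁.choose_spec
    generalize h₁.choose = i at hs ⊢
    obtain ⟨-, hs⟩ := hs
    dsimp only
    generalize m i = a at hs ⊢
    subst hs
    exact detects_nsmul_e q i (by rwa [size_nsmul, size_e, Nat.mul_one] at hm)
  · have hs := h₂.choose_spec
    generalize h₂.choose = a at hs ⊢
    obtain ⟨i, j⟩ := a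
    obtain ⟨hij, hb, hs⟩ := hs
    dsimp only at hij hb hs ⊢
    generalize m j = b at hb hs ⊢
    have hs' : m = pairDeg i j 1 b := by rw [hs, pairDeg, one_smul]
    subst hs'
    exact detects_one q hij hb
  · have hs := h₃.choose_spec
    generalize h₃.choose = a at hs ⊢
    obtain ⟨i, j⟩ := a
    obtain ⟨hij, hb, hs⟩ := hs
    dsimp only at hij hb hs ⊢
    generalize m j = b at hb hs ⊢
    subst hs
    exact detects_two q hij hb
  · have hs := h₄.choose_spec
    generalize h₄.choose = a at hs ⊢
    obtain ⟨hij, rfl⟩ := hs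
    exact detects_three_three q hij
  · have hs := h₅.choose_spec
    generalize h₅.choose = a at hs ⊢
    obtain ⟨hij, rfl⟩ := hs
    exact detects_three_four q hij
  · have hs := h₆.choose_spec
    generalize h₆.choose = a at hs ⊢
    obtain ⟨hij, rfl⟩ := hs
    exact detects_three_six q hij
  · have hs := h₇.choose_spec
    generalize h₇.choose = a at hs ⊢
    obtain ⟨hij, rfl⟩ := hs
    exact detects_four_four q hij
  · exact detects_generic q hm

theorem sub_e_lt {m : Fin n → ℕ} {i : Fin n} (hi : 0 < m i) : m - e i < m := by
  refine lt_of_le_of_ne (fun k => Nat.sub_le _ _) fun h => ?_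
  have := congrFun h i
  rw [sub_e_self] at this
  omega

theorem injective_shuffleOp_of_size_eq_one {m : Fin n → ℕ} (hm : size m = 1) :
    Function.Injective (shuffleOp q m) := by
  rw [shuffleOp, hm, Finset.sum_range_one, moveOp_zero]
  exact Function.injective_id

/-- If no `P_l` with `l ≤ m` vanishes at `q`, then `S_{1,|m|-1}` is injective in degree `m`. -/
theorem injective_shuffleOp [CharZero K] {m : Fin n → ℕ} (hm : 1 ≤ size m)
    (hP : ∀ l : Fin n → ℕ, l ≤ m → 2 ≤ size l → evalAt q (P l) ≠ 0) :
    Function.Injective (shuffleOp q m) := by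
  induction hs : size m generalizing m with
  | zero => omega
  | succ s ih =>
    rcases Nat.eq_zero_or_pos s with rfl | hs0
    · exact injective_shuffleOp_of_size_eq_one q hs
    have hm2 : 2 ≤ size m := by omega
    have hinj := injective_sum_moveOp q hm2 fun i hi => ih (m := m - e i)
      (by rw [size_sub_e hi]; omega) (fun l hl => hP l (hl.trans (sub_e_lt hi).le))
      (by rw [size_sub_e hi]; omega)
    -- If Q^N = 1, the equation dim ker + n₂ = n₁ together with n₁ ≤ n₂ leaves dimension 0.
    by_cases hQ : evalAt q (Q m) ^ N m = 1
    · have h1 := finrank_ker_shuffleOp q hm2 hQ hinj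
      have h2 := (detects_P q hm2).2 hQ (hP m le_rfl hm2)
      rw [← LinearMap.ker_eq_bot, ← Submodule.finrank_eq_zero (R := K)]
      omega
    · exact injective_shuffleOp_of_ne_one q hm2 hQ hinj

theorem finrank_ker_shuffleOp_of_minimal [CharZero K] {m : Fin n → ℕ} (hm : 2 ≤ size m)
    (hP : evalAt q (P m) = 0)
    (hl : ∀ l : Fin n → ℕ, l < m → 2 ≤ size l → evalAt q (P l) ≠ 0) :
    Module.finrank K (LinearMap.ker (shuffleOp q m)) + n₂ q m = n₁ q m :=
  finrank_ker_shuffleOp q hm ((detects_P q hm).1 hP) <|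
    injective_sum_moveOp q hm fun i hi => injective_shuffleOp q (by rw [size_sub_e hi]; omega)
      fun l hlm => hl l (hlm.trans_lt (sub_e_lt hi))

end Criterion

/-! ### Transfer from words to the tensor power. -/

section Tensor

variable {n : ℕ}

theorem ofFn_swap {r : ℕ} {g : Fin r → Fin n} {i : Fin (r - 1)} {L R : List (Fin n)} {a b : Fin n}
    (hL : L.length = i) (hg : List.ofFn g = L ++ a :: b :: R) :
    g (posL i) = a ∧ g (posR i) = b ∧
      List.ofFn (g ∘ Equiv.swap (posL i) (posR i)) = L ++ b :: a :: R := by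
  have hlen : r = L.length + (R.length + 2) := by
    have := congrArg List.length hg
    simpa using this
  have hget : ∀ (s : ℕ) (hs : s < r), g ⟨s, hs⟩ = (L ++ a :: b :: R)[s]'(by simp; omega) := by
    intro s hs
    simp [← hg]
  have ha : g (posL i) = a := by
    rw [posL, hget]
    simp [← hL]
  have hb : g (posR i) = b := by
    rw [posR, hget]
    simp [← hL]
  refine ⟨ha, hb, List.ext_getElem (by simp; omega) fun s h1 h2 => ?_⟩
  have hs : s < r := by simpa using h1
  rw [List.getElem_ofFn, Function.comp_apply]
  by_cases hsL : s = L.length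
  · have : (⟨s, hs⟩ : Fin r) = posL i := by simp [posL, hsL, hL]
    rw [this, Equiv.swap_apply_left, hb]
    simp [hsL]
  by_cases hsR : s = L.length + 1
  · have : (⟨s, hs⟩ : Fin r) = posR i := by simp [posR, hsR, hL]
    rw [this, Equiv.swap_apply_right, ha]
    simp [hsR]
  rw [Equiv.swap_apply_of_ne_of_ne (by simp [posL]; omega) (by simp [posR]; omega), hget]
  rcases Nat.lt_or_ge s L.length with h | h
  · rw [List.getElem_append_left h, List.getElem_append_left h]
  · obtain ⟨k, rfl⟩ := Nat.exists_eq_add_of_le h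
    obtain ⟨k, rfl⟩ := Nat.exists_eq_add_of_le (show 2 ≤ k by omega)
    rw [List.getElem_append_right (by omega), List.getElem_append_right (by omega)]
    simp [show L.length + (2 + k) - L.length = k + 1 + 1 by omega]

theorem descProd_succ {r t : ℕ} (ht : t < r - 1) :
    descProd r (t + 1) = σ ⟨t, ht⟩ * descProd r t := by
  rw [descProd, descProd, List.take_succ_eq_append_getElem (by simpa using ht)]
  simp

variable {K : Type*} [Field K] {V : Type*} [AddCommGroup V] [Module K V]
  (x : Module.Basis (Fin n) K V) (q : Fin n → Fin n → K)

theorem ρ_of_σ {r : ℕ} (i : Fin (r - 1)) :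
    ρ x q r (MonoidAlgebra.of K (BraidMonoid r) (σ i)) = braidOp x q i := by
  rw [ρ, MonoidAlgebra.lift_of, σ, PresentedMonoid.lift_of]

/-- Each further generator carries the original first letter past one more letter. This identifies
the braid action with the operators `moveOp`. -/
theorem ρ_descProd_wordTensor {r : ℕ} (f : Fin r → Fin n) (t : ℕ) (ht : t < r) :
    ∃ g : Fin r → Fin n, List.ofFn g = moveFirst t (List.ofFn f) ∧
      ρ x q r (MonoidAlgebra.of K (BraidMonoid r) (descProd r t)) (wordTensor x f) =
        moveCoef q t (List.ofFn f) • wordTensor x g := by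
  obtain ⟨a, v, hf⟩ := List.exists_cons_of_ne_nil (l := List.ofFn f)
    (by rw [← List.length_pos_iff, List.length_ofFn]; omega)
  have hlen : v.length + 1 = r := by
    have := congrArg List.length hf
    simpa using this.symm
  rw [hf]
  induction t with
  | zero =>
    refine ⟨f, by simpa using hf, ?_⟩
    have h1 : descProd r 0 = 1 := by simp [descProd]
    rw [h1, map_one, map_one, Module.End.one_apply]
    simp
  | succ t ih =>
    obtain ⟨g, hg, hρ⟩ := ih (by omega)
    have htv : t < v.length := by omega
    rw [moveFirst_cons, List.drop_eq_getElem_cons htv] at hg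
    obtain ⟨h1, h2, h3⟩ := ofFn_swap (i := ⟨t, by omega⟩) (by simp; omega) hg
    refine ⟨_, h3.trans ?_, ?_⟩
    · rw [moveFirst_cons, List.take_succ_eq_append_getElem htv, List.append_assoc,
        List.singleton_append]
    · rw [descProd_succ (by omega), map_mul, map_mul, Module.End.mul_apply, hρ, map_smul, ρ_of_σ,
        braidOp_wordTensor, h1, h2, smul_smul, moveCoef_cons, moveCoef_cons,
        List.take_succ_eq_append_getElem htv, List.map_append, List.prod_append,
        List.map_singleton, List.prod_singleton]

/-- A word of degree `m` as a function. -/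
def wordFn {m : Fin n → ℕ} (w : words m) : Fin (size m) → Fin n :=
  fun t => w.1.get (Fin.cast (length_words w).symm t)

theorem ofFn_wordFn {m : Fin n → ℕ} (w : words m) : List.ofFn (wordFn w) = w.1 := by
  refine List.ext_getElem (by simp [length_words w]) fun s h1 h2 => ?_
  simp [wordFn]

theorem wordFn_eq {m : Fin n → ℕ} (w : words m) {g : Fin (size m) → Fin n}
    (hg : List.ofFn g = w.1) : wordFn w = g :=
  List.ofFn_injective ((ofFn_wordFn w).trans hg.symm)

/-- The embedding of the span of the words of degree `m` into the tensor power. -/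
noncomputable def toTensor (m : Fin n → ℕ) : (words m →₀ K) →ₗ[K] TensorPower K (size m) V :=
  Finsupp.linearCombination K fun w => wordTensor x (wordFn w)

theorem toTensor_single (m : Fin n → ℕ) (w : words m) :
    toTensor x m (Finsupp.single w 1) = wordTensor x (wordFn w) := by
  rw [toTensor, Finsupp.linearCombination_single, one_smul]

theorem toTensor_injective (m : Fin n → ℕ) : Function.Injective (toTensor x m) := by
  have hb := (Basis.piTensorProduct fun _ : Fin (size m) => x).linearIndependent
  have hinj : Function.Injective (wordFn (m := m)) := fun w w' h =>
    Subtype.ext (by rw [← ofFn_wordFn w, h, ofFn_wordFn])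
  have h := hb.comp _ hinj
  have heq : (⇑(Basis.piTensorProduct fun _ : Fin (size m) => x) ∘ wordFn (m := m)) =
      fun w => wordTensor x (wordFn w) := by
    funext w
    rw [Function.comp_apply, Basis.piTensorProduct_apply]; rfl
  rw [heq] at h
  exact h

theorem range_toTensor (m : Fin n → ℕ) : LinearMap.range (toTensor x m) = component x m := by
  rw [toTensor, Finsupp.range_linearCombination, component]
  congr 1
  ext y
  constructor
  · rintro ⟨w, rfl⟩
    exact ⟨wordFn w, by rw [ofFn_wordFn]; exact mem_words.1 w.2, rfl⟩
  · rintro ⟨g, hg, rfl⟩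
    exact ⟨⟨List.ofFn g, mem_words.2 hg⟩, congrArg (wordTensor x) (wordFn_eq _ rfl)⟩

theorem ρ_S_toTensor {m : Fin n → ℕ} (hm : 0 < size m) (y : words m →₀ K) :
    ρ x q (size m) (S K (size m) (size m - 1)) (toTensor x m y) =
      toTensor x m (shuffleOp q m y) := by
  have : ρ x q (size m) (S K (size m) (size m - 1)) ∘ₗ toTensor x m =
      toTensor x m ∘ₗ shuffleOp q m := by
    refine words_end_ext fun w => ?_
    rw [LinearMap.comp_apply, LinearMap.comp_apply, toTensor_single, S, shuffleOp,
      Nat.sub_add_cancel hm, map_sum, LinearMap.sum_apply, LinearMap.sum_apply, map_sum]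
    refine Finset.sum_congr rfl fun t ht => ?_
    obtain ⟨g, hg, hρ⟩ := ρ_descProd_wordTensor x q (wordFn w) t (Finset.mem_range.1 ht)
    rw [ofFn_wordFn] at hg hρ
    rw [hρ, moveOp_single, map_smul, toTensor_single, wordFn_eq (moveWord m t w) hg]
  exact LinearMap.congr_fun this y

/-- Both kernels embed into the tensor power with the same image. -/
theorem finrank_ker_domRestrict {m : Fin n → ℕ} (hm : 0 < size m) :
    Module.finrank K (LinearMap.ker ((ρ x q (size m) (S K (size m) (size m - 1))).domRestrict
      (component x m))) = Module.finrank K (LinearMap.ker (shuffleOp q m)) := by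
  have h : (LinearMap.ker ((ρ x q (size m) (S K (size m) (size m - 1))).domRestrict
      (component x m))).map (component x m).subtype =
      (LinearMap.ker (shuffleOp q m)).map (toTensor x m) := by
    ext y
    simp only [Submodule.mem_map, LinearMap.mem_ker, Submodule.subtype_apply, Subtype.exists,
      LinearMap.domRestrict_apply]
    constructor
    · rintro ⟨y, hy, h, rfl⟩
      rw [← range_toTensor] at hy
      obtain ⟨z, rfl⟩ := hy
      rw [ρ_S_toTensor x q hm] at h
      exact ⟨z, toTensor_injective x m (by rw [h, map_zero]), rfl⟩
    · rintro ⟨z, hz, rfl⟩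
      refine ⟨toTensor x m z, ?_, ?_, rfl⟩
      · rw [← range_toTensor]; exact ⟨z, rfl⟩
      · rw [ρ_S_toTensor x q hm, hz, map_zero]
  rw [LinearEquiv.finrank_eq (Submodule.equivMapOfInjective (toTensor x m)
      (toTensor_injective x m) (LinearMap.ker (shuffleOp q m))), ← h,
    ← LinearEquiv.finrank_eq (Submodule.equivMapOfInjective (component x m).subtype
      Subtype.val_injective _)]

end Tensor

end ShuffleKernel

theorem theorem6p2 {K : Type*} [Field K] [CharZero K] {V : Type*} [AddCommGroup V] [Module K V]
    {n : ℕ} (x : Module.Basis (Fin n) K V) (q : Fin n → Fin n → K) (hq : ∀ i j, q i j ≠ 0)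
    (m : Fin n → ℕ) (hm : 2 ≤ ShuffleKernel.size m)
    (hP : ShuffleKernel.evalAt q (ShuffleKernel.P m) = 0)
    (hl : ∀ l : Fin n → ℕ, l < m → 2 ≤ ShuffleKernel.size l →
      ShuffleKernel.evalAt q (ShuffleKernel.P l) ≠ 0) :
    (Module.finrank K (LinearMap.ker
        ((ShuffleKernel.ρ x q (ShuffleKernel.size m)
          (ShuffleKernel.S K (ShuffleKernel.size m) (ShuffleKernel.size m - 1))).domRestrict
            (ShuffleKernel.component x m))) : ℤ) =
      (ShuffleKernel.n₁ q m : ℤ) - (ShuffleKernel.n₂ q m : ℤ) := by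
  have h := ShuffleKernel.finrank_ker_shuffleOp_of_minimal q hm hP hl
  rw [ShuffleKernel.finrank_ker_domRestrict x q (by omega)]
  omega
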